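/- Let $n\ge 1$ be an integer, $\alpha>0$, $1<q\le 1+\frac{\alpha}{n}$ and $c>0$. Put $\mathbb E=\mathbb R\times\mathbb R^n$ and let $$\mathcal L=\sum_{i,j=1}^n\frac{\partial}{\partial x_i}\Big[a_{ij}(t,x)\frac{\partial}{\partial x_j}\Big],$$ where the $a_{ij}$ are measurable and locally bounded on $\mathbb E$, $a_{ij}=a_{ji}$ almost everywhere, and $$0\le\sum_{i,j=1}^n a_{ij}(t,x)\xi_i\xi_j\le A(t,x)|\xi|^2\qquad\text{for all }\xi\in\mathbb R^n\text{ and almost all }(t,x)\in\mathbb E,$$ with $A$ measurable, non-negative and locally bounded on $\mathbb E$. Assume that $$\operatorname*{ess\,sup}_{(t,x)\in\mathbb R\times\{R/2<|x|<R\}}A(t,x)\le cR^{2-\alpha}\qquad\text{for all }R>1 .$$ For a bounded domain $\Omega\subset\mathbb E$ let $W^{\mathcal L,q}(\Omega)$ be the completion of the space of functions in $C^\infty(\Omega)$ of finite norm $$\|w\|=\int_\Omega|w_t|\,dt\,dx+\Big[\int_\Omega\sum_{i,j}a_{ij}w_{x_i}w_{x_j}\,dt\,dx\Big]^{1/2}+\Big[\int_\Omega|w|^{q}\,dt\,dx\Big]^{1/q};$$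 an element of it is a function $w$ together with $w_t$ and $\nabla_x w$ (the latter modulo fields with zero energy), the limits of the corresponding quantities of the approximating smooth functions. A function on $\mathbb E$, with such derivatives on $\mathbb E$, belongs to $W^{\mathcal L,q}_{\rm loc}(\mathbb E)$ if it belongs to $W^{\mathcal L,q}(\Omega)$ for every bounded domain $\Omega\subset\mathbb E$. Let $u,v$ be measurable functions in $W^{\mathcal L,q}_{\rm loc}(\mathbb E)$ such that $(u,v)$ is a weak solution of $$u_t-\mathcal Lu-|u|^{q-1}u\ \ge\ v_t-\mathcal Lv-|v|^{q-1}v\qquad\text{in }\mathbb E,$$ that is, for every non-negative $\varphi\in C^\infty(\mathbb E)$ with compact support, $$\int_{\mathbb E}\Big[u_t\varphi+\sum_{i,j}a_{ij}\varphi_{x_i}u_{x_j}-|u|^{q-1}u\varphi\Big]dt\,dx\ \ge\ \int_{\mathbb E}\Big[v_t\varphi+\sum_{i,j}a_{ij}\varphi_{x_i}v_{x_j}-|v|^{q-1}v\varphi\Big]dt\,dx .$$ If $u\ge v$ almost everywhere in $\mathbb E$, then $u=v$ almost everywhere in $\mathbb E$. -/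

import Mathlib

open MeasureTheory Filter Topology
open scoped ContDiff

noncomputable section

/-- The space-time `𝔼 = ℝ × ℝⁿ` of points `(t, x)`, with Lebesgue measure `dt dx` as `volume`. -/
abbrev SpaceTime (n : ℕ) : Type := ℝ × EuclideanSpace ℝ (Fin n)

/-- The bilinear form `∑ i j, a_ij(t,x) ξ_i η_j` of the coefficient matrix `a` at `p = (t,x)`. -/
def coeffForm {n : ℕ} (a : SpaceTime n → Matrix (Fin n) (Fin n) ℝ) (p : SpaceTime n)
    (ξ η : EuclideanSpace ℝ (Fin n)) : ℝ :=
  ∑ i, ∑ j, a p i j * ξ i * η j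

/-- `f` is bounded on every compact subset of space-time. -/
def LocallyBounded {n : ℕ} (f : SpaceTime n → ℝ) : Prop :=
  ∀ K : Set (SpaceTime n), IsCompact K → ∃ C : ℝ, ∀ p ∈ K, |f p| ≤ C

/-- The standing assumptions on the operator `𝓛 = ∑ i j, ∂/∂x_i [a_ij(t,x) ∂/∂x_j]` and on the
function `A` that bounds its quadratic form. `AEMeasurable` is Lebesgue measurability. -/
structure IsDivFormOperator {n : ℕ} (a : SpaceTime n → Matrix (Fin n) (Fin n) ℝ)
    (A : SpaceTime n → ℝ) : Prop where
  coeff_measurable : ∀ i j, AEMeasurable (fun p => a p i j) volume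
  coeff_locallyBounded : ∀ i j, LocallyBounded (fun p => a p i j)
  coeff_symm : ∀ i j, ∀ᵐ p : SpaceTime n, a p i j = a p j i
  bound_measurable : AEMeasurable A volume
  bound_locallyBounded : LocallyBounded A
  bound_nonneg : ∀ p, 0 ≤ A p
  form_nonneg : ∀ᵐ p : SpaceTime n, ∀ ξ, 0 ≤ coeffForm a p ξ ξ
  form_le : ∀ᵐ p : SpaceTime n, ∀ ξ, coeffForm a p ξ ξ ≤ A p * ‖ξ‖ ^ 2

/-- `𝒜(R) = ess sup A(t,x)` over all `t ∈ ℝ` and `R/2 < |x| < R`, with values in `[0,∞]`. -/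
def annulusEssSup {n : ℕ} (A : SpaceTime n → ℝ) (R : ℝ) : ENNReal :=
  essSup (fun p => ENNReal.ofReal (A p))
    (volume.restrict {p : SpaceTime n | R / 2 < ‖p.2‖ ∧ ‖p.2‖ < R})

/-- The classical time derivative `f_t`. -/
def timeDeriv {n : ℕ} (f : SpaceTime n → ℝ) (p : SpaceTime n) : ℝ :=
  fderiv ℝ f p (1, 0)

/-- The classical spatial gradient `(∂f/∂x_1, …, ∂f/∂x_n)`. -/
def spaceGrad {n : ℕ} (f : SpaceTime n → ℝ) (p : SpaceTime n) : EuclideanSpace ℝ (Fin n) :=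
  WithLp.toLp 2 fun i => fderiv ℝ f p (0, EuclideanSpace.single i 1)

/-- The norm of `W^{𝓛,q}(Ω)`, as an element of `[0,∞]`, for a function `w` with time derivative
`wt` and spatial gradient `G`:
`∫_Ω |wt| + (∫_Ω ∑ a_ij G_i G_j)^{1/2} + (∫_Ω |w|^{q̂})^{1/q̂}`, where `q̂ = max {1, q}`. -/
def sobolevNorm {n : ℕ} (a : SpaceTime n → Matrix (Fin n) (Fin n) ℝ) (q : ℝ)
    (Ω : Set (SpaceTime n)) (w wt : SpaceTime n → ℝ)
    (G : SpaceTime n → EuclideanSpace ℝ (Fin n)) : ENNReal :=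
  (∫⁻ p in Ω, ENNReal.ofReal |wt p|)
    + (∫⁻ p in Ω, ENNReal.ofReal (coeffForm a p (G p) (G p))) ^ (1 / 2 : ℝ)
    + (∫⁻ p in Ω, ENNReal.ofReal (|w p| ^ max 1 q)) ^ (1 / max 1 q)

/-- `w`, with time derivative `wt` and spatial gradient `G`, is an element of the completion
`W^{𝓛,q}(Ω)` of the smooth functions on `Ω` of finite norm.

The completion embeds isometrically, by `f ↦ (f, f_t, ∇f)`, as the closure of the smooth functions
in the complete space of triples `(w, wt, G)` in which `w ∈ L^{q̂}(Ω)`, `wt ∈ L¹(Ω)`, and `G` lies in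
the space of vector fields square integrable for the form `a`, modulo those with `a G · G = 0` a.e.
If `a` degenerates, `G` need not be determined by `w`; the element of the completion carries it. -/
structure MemW {n : ℕ} (a : SpaceTime n → Matrix (Fin n) (Fin n) ℝ) (q : ℝ)
    (Ω : Set (SpaceTime n)) (w wt : SpaceTime n → ℝ)
    (G : SpaceTime n → EuclideanSpace ℝ (Fin n)) : Prop where
  aemeasurable : AEMeasurable w (volume.restrict Ω)
  aemeasurable_time : AEMeasurable wt (volume.restrict Ω)
  aemeasurable_grad : AEMeasurable G (volume.restrict Ω)
  exists_approx : ∃ f : ℕ → SpaceTime n → ℝ,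
    (∀ k, ContDiffOn ℝ ∞ (f k) Ω) ∧
    (∀ k, sobolevNorm a q Ω (f k) (timeDeriv (f k)) (spaceGrad (f k)) < ⊤) ∧
    Tendsto (fun k => sobolevNorm a q Ω (fun p => w p - f k p)
      (fun p => wt p - timeDeriv (f k) p) (fun p => G p - spaceGrad (f k) p)) atTop (𝓝 0)

/-- `w`, with time derivative `wt` and spatial gradient `G`, belongs to `W^{𝓛,q}_loc(𝔼)`: it belongs
to `W^{𝓛,q}(Ω)` for every bounded domain `Ω` in `𝔼`. -/
def MemWloc {n : ℕ} (a : SpaceTime n → Matrix (Fin n) (Fin n) ℝ) (q : ℝ)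
    (w wt : SpaceTime n → ℝ) (G : SpaceTime n → EuclideanSpace ℝ (Fin n)) : Prop :=
  ∀ Ω : Set (SpaceTime n), IsOpen Ω → IsConnected Ω → Bornology.IsBounded Ω → MemW a q Ω w wt G

/-- `∫_𝔼 [w_t φ + ∑ a_ij φ_{x_i} w_{x_j} - |w|^{q-1} w φ] dt dx`. -/
def weakForm {n : ℕ} (a : SpaceTime n → Matrix (Fin n) (Fin n) ℝ) (q : ℝ)
    (w wt : SpaceTime n → ℝ) (G : SpaceTime n → EuclideanSpace ℝ (Fin n))
    (φ : SpaceTime n → ℝ) : ℝ :=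
  ∫ p : SpaceTime n,
    (wt p * φ p + coeffForm a p (spaceGrad φ p) (G p) - |w p| ^ (q - 1) * w p * φ p)

/-- `(u, v)` is a weak solution in `𝔼` of `u_t - 𝓛u - |u|^{q-1}u ≥ v_t - 𝓛v - |v|^{q-1}v`. -/
def IsWeakSolution {n : ℕ} (a : SpaceTime n → Matrix (Fin n) (Fin n) ℝ) (q : ℝ)
    (u v : SpaceTime n → ℝ) : Prop :=
  AEMeasurable u volume ∧ AEMeasurable v volume ∧
  ∃ (ut vt : SpaceTime n → ℝ) (Gu Gv : SpaceTime n → EuclideanSpace ℝ (Fin n)),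
    MemWloc a q u ut Gu ∧ MemWloc a q v vt Gv ∧
    ∀ φ : SpaceTime n → ℝ, ContDiff ℝ ∞ φ → HasCompactSupport φ → (∀ p, 0 ≤ φ p) →
      weakForm a q v vt Gv φ ≤ weakForm a q u ut Gu φ

end

/-! The proof uses nonlinear capacity. Put `w = u - v ≥ 0`; since `s ↦ |s|^{q-1} s` is strongly
monotone (`rpow_sub_le_mul_sub`), `w` satisfies `w_t - 𝓛w ≥ 2^{1-q} w^q` weakly. This is tested with
`g(w) η^m`, where `η` is a cut-off which is one on the box `Q = {|t| ≤ R^α, |x| ≤ R}` and supported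
in its double, and `g` decreases from at most two to one at the rate
`-g'(w) ≳ b (1 + b w)^{-(1+μ)}` with `1 + μ < q`. Such a test function is admissible by approximation
(`weak_inequality_comp`). Since `g' < 0` on the range of `w`, the energy term which `g'` produces has
a good sign and absorbs the gradient of `w` in the mixed term, with a cost proportional to
`1 / |g'(w)|` (`diffusion_term_le`); since `g` is bounded, a primitive of `g` grows at most linearly,
so the time term costs at most a multiple of `w |η_t|`. The bound on `A` over annuli makes both
`|η_t|` and `a(∇η, ∇η)` of order `R^{-α}`, and both vanish on `Q`. Hence (`exists_weighted_estimate`)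
`∫ w^q η^m ≤ C (R^{-α} / b) ∫_{Qᶜ} η^{m-2} (1 + b w)^{1+μ}`
with `C` independent of `R ≥ 1` and of `b > 0`.

Take `b = B R^{α/(q-1)}`. Then `R^{-α} b^{q-1} = B^{q-1}`, and `R^{-α} / b` times the volume of the
box is of order `R^{n - α/(q-1)} / B`, which the condition `q ≤ 1 + α/n` bounds by `1 / B`. With
`B = 1`, the right-hand side is absorbed up to a constant by Young's inequality, if `m` is large
(`exists_cutoff_young`); this bounds `∫_Q w^q` for all `R`, so `w^q` is integrable on space-time. With
general `B`, one gets `∫_Q w^q ≤ C / B + C B^{q-1} ∫_{Qᶜ} w^q`, and now the last integral tends to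
zero as `R → ∞`. Letting then `B → ∞` yields `∫ w^q = 0`, also in the critical case. -/

noncomputable section

/-! ### Elementary inequalities -/

theorem rpow_add_le_mul_rpow_add {x y p : ℝ} (hx : 0 ≤ x) (hy : 0 ≤ y) (hp : 1 ≤ p) :
    (x + y) ^ p ≤ 2 ^ (p - 1) * (x ^ p + y ^ p) := by
  lift x to NNReal using hx
  lift y to NNReal using hy
  exact_mod_cast NNReal.rpow_add_le_mul_rpow_add_rpow x y hp

theorem rpow_sub_one_mul_self {x q : ℝ} (hx : 0 ≤ x) (hq : 1 < q) : x ^ (q - 1) * x = x ^ q := by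
  rcases hx.eq_or_lt with rfl | hx
  · rw [mul_zero, Real.zero_rpow (by linarith)]
  · rw [← Real.rpow_add_one hx.ne', sub_add_cancel]

/-- The nonlinearity `s ↦ |s|^{q-1} s` is strongly monotone. -/
theorem rpow_sub_le_mul_sub {q x y : ℝ} (hq : 1 < q) (hxy : y ≤ x) :
    (x - y) ^ q ≤ 2 ^ (q - 1) * (|x| ^ (q - 1) * x - |y| ^ (q - 1) * y) := by
  have h2 : (1 : ℝ) ≤ 2 ^ (q - 1) := Real.one_le_rpow (by norm_num) (by linarith)
  have key : ∀ z ≥ (0 : ℝ), ∀ d ≥ (0 : ℝ), d ^ q ≤ 2 ^ (q - 1) * ((z + d) ^ q - z ^ q) := by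
    intro z hz d hd
    have h := Real.add_rpow_le_rpow_add hz hd hq.le
    have hd' : 0 ≤ d ^ q := Real.rpow_nonneg hd _
    nlinarith
  rcases le_total 0 y with hy | hy
  · have hx : 0 ≤ x := hy.trans hxy
    have := key y hy (x - y) (by linarith)
    rw [add_sub_cancel, ← rpow_sub_one_mul_self hx hq, ← rpow_sub_one_mul_self hy hq] at this
    rwa [abs_of_nonneg hx, abs_of_nonneg hy]
  · rcases le_total 0 x with hx | hx
    · have h := rpow_add_le_mul_rpow_add hx (neg_nonneg.2 hy) hq.le
      rw [← rpow_sub_one_mul_self hx hq, ← rpow_sub_one_mul_self (neg_nonneg.2 hy) hq] at h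
      rw [abs_of_nonneg hx, abs_of_nonpos hy]
      calc (x - y) ^ q = (x + -y) ^ q := by rw [sub_eq_add_neg]
        _ ≤ _ := h
        _ = _ := by ring
    · have := key (-x) (neg_nonneg.2 hx) (x - y) (by linarith)
      rw [show -x + (x - y) = -y by ring, ← rpow_sub_one_mul_self (neg_nonneg.2 hx) hq,
        ← rpow_sub_one_mul_self (neg_nonneg.2 hy) hq] at this
      rw [abs_of_nonpos hx, abs_of_nonpos hy]
      calc _ ≤ _ := this
        _ = _ := by ring

/-- Young's inequality with a small constant. -/
theorem exists_rpow_le_add_mul_rpow {p q τ : ℝ} (hp : 0 < p) (hpq : p < q) (hτ : 0 < τ) :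
    ∃ K : ℝ, 0 ≤ K ∧ ∀ x : ℝ, 0 ≤ x → x ^ p ≤ K + τ * x ^ q := by
  set T : ℝ := τ ^ (-(q - p)⁻¹)
  have hT : 0 < T := Real.rpow_pos_of_pos hτ _
  refine ⟨T ^ p, Real.rpow_nonneg hT.le _, fun x hx => ?_⟩
  rcases le_total x T with h | h
  · have h1 := Real.rpow_le_rpow hx h hp.le
    have h2 : 0 ≤ τ * x ^ q := mul_nonneg hτ.le (Real.rpow_nonneg hx _)
    linarith
  · have hx0 : 0 < x := hT.trans_le h
    have h1 : x ^ (p - q) ≤ T ^ (p - q) :=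
      Real.rpow_le_rpow_of_nonpos hT h (by linarith)
    have h2 : T ^ (p - q) = τ := by
      rw [← Real.rpow_mul hτ.le, show -(q - p)⁻¹ * (p - q) = 1 by
        have : q - p ≠ 0 := by linarith
        field_simp; ring, Real.rpow_one]
    have h3 : x ^ p = x ^ (p - q) * x ^ q := by
      rw [← Real.rpow_add hx0, sub_add_cancel]
    rw [h2] at h1
    have h4 := mul_le_mul_of_nonneg_right h1 (Real.rpow_nonneg hx q)
    have h5 := Real.rpow_nonneg hT.le p
    rw [h3]; linarith

theorem one_add_rpow_le {q y : ℝ} (hq : 1 ≤ q) (hy : 0 ≤ y) :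
    (1 + y) ^ q ≤ 2 ^ (q - 1) * (1 + y ^ q) := by
  simpa using rpow_add_le_mul_rpow_add zero_le_one hy hq

/-- Young's inequality for the cut-off integrals: a high power `e ^ m` of a cut-off `e` leaves
room for absorbing the subcritical term into `y ^ q * e ^ m`. -/
theorem exists_cutoff_young {p q τ : ℝ} {m : ℕ} (hp : 0 < p) (hq : 1 < q) (hpq : p < q)
    (hτ : 0 < τ) (hm : m * (p / q) + 2 ≤ m) :
    ∃ K : ℝ, 0 ≤ K ∧ ∀ e y : ℝ, 0 ≤ e → e ≤ 1 → 0 ≤ y →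
      e ^ (m - 2) * (1 + y) ^ p ≤ K + τ * (y ^ q * e ^ m) := by
  have h2 : (0 : ℝ) < 2 ^ (q - 1) := Real.rpow_pos_of_pos (by norm_num) _
  obtain ⟨K, hK, hKx⟩ := exists_rpow_le_add_mul_rpow hp hpq (div_pos hτ h2)
  refine ⟨K + τ, by positivity, fun e y he he1 hy => ?_⟩
  have hq0 : (0 : ℝ) < q := by linarith
  have hm2 : 2 ≤ m := by
    have h : (0 : ℝ) ≤ m * (p / q) := by positivity
    have : ((2 : ℕ) : ℝ) ≤ m := by push_cast; linarith
    exact_mod_cast this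
  have hy1 : 0 ≤ 1 + y := by linarith
  set X : ℝ := (1 + y) * e ^ ((m : ℝ) / q)
  have hX : 0 ≤ X := mul_nonneg hy1 (Real.rpow_nonneg he _)
  have hXp : e ^ (m - 2) * (1 + y) ^ p ≤ X ^ p := by
    have : X ^ p = (1 + y) ^ p * e ^ ((m : ℝ) * (p / q)) := by
      rw [Real.mul_rpow hy1 (Real.rpow_nonneg he _), ← Real.rpow_mul he]
      congr 2; ring
    rw [this, mul_comm]
    refine mul_le_mul_of_nonneg_left ?_ (Real.rpow_nonneg hy1 _)
    rw [← Real.rpow_natCast]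
    refine Real.rpow_le_rpow_of_exponent_ge' he he1 (by positivity) ?_
    push_cast [Nat.cast_sub hm2]; linarith
  have hXq : X ^ q = (1 + y) ^ q * e ^ m := by
    rw [Real.mul_rpow hy1 (Real.rpow_nonneg he _), ← Real.rpow_mul he,
      div_mul_cancel₀ _ hq0.ne', Real.rpow_natCast]
  have hem : e ^ m ≤ 1 := pow_le_one₀ he he1
  have hem0 : 0 ≤ e ^ m := pow_nonneg he m
  have h3 : X ^ q ≤ 2 ^ (q - 1) * (1 + y ^ q * e ^ m) := by
    rw [hXq]
    have := mul_le_mul_of_nonneg_right (one_add_rpow_le hq.le hy) hem0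
    nlinarith
  have h4 : τ / 2 ^ (q - 1) * X ^ q ≤ τ * (1 + y ^ q * e ^ m) := by
    calc _ ≤ τ / 2 ^ (q - 1) * (2 ^ (q - 1) * (1 + y ^ q * e ^ m)) := by gcongr
      _ = _ := by field_simp
  have := hKx X hX
  linarith

/-! ### The profile of the test function -/

/-- A smooth profile with values in `[1, 2]` which on `[0, ∞)` decreases at the rate
`(1 + s)^{-(1 + μ)}`; the shift by one keeps the derivative away from zero at `s = 0`. -/
def profile (μ s : ℝ) : ℝ := 1 + (1 + (1 + s) ^ 2) ^ (-(μ / 2))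

/-- The derivative of `profile`. -/
def profileDeriv (μ s : ℝ) : ℝ := -(μ * (1 + s) * (1 + (1 + s) ^ 2) ^ (-(μ / 2) - 1))

theorem one_le_profile (μ s : ℝ) : 1 ≤ profile μ s :=
  le_add_of_nonneg_right (Real.rpow_nonneg (by positivity) _)

theorem profile_le_two {μ : ℝ} (hμ : 0 ≤ μ) (s : ℝ) : profile μ s ≤ 2 := by
  have : (1 + (1 + s) ^ 2) ^ (-(μ / 2)) ≤ 1 :=
    Real.rpow_le_one_of_one_le_of_nonpos (by nlinarith [sq_nonneg (1 + s)]) (by linarith)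
  unfold profile; linarith

theorem contDiff_profile (μ : ℝ) : ContDiff ℝ ∞ (profile μ) := by
  unfold profile
  refine contDiff_const.add (ContDiff.rpow_const_of_ne (by fun_prop) fun s => ?_)
  positivity

theorem hasDerivAt_profile (μ s : ℝ) : HasDerivAt (profile μ) (profileDeriv μ s) s := by
  have h0 : HasDerivAt (fun s : ℝ => 1 + (1 + s) ^ 2) (2 * (1 + s)) s := by
    have := (((hasDerivAt_id s).const_add 1).pow 2).const_add 1
    simpa using this
  have h1 := (h0.rpow_const (p := -(μ / 2)) (Or.inl (by positivity))).const_add 1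
  refine h1.congr_deriv ?_
  unfold profileDeriv; ring

theorem abs_profileDeriv_le {μ : ℝ} (hμ : 0 ≤ μ) (s : ℝ) : |profileDeriv μ s| ≤ μ := by
  have hx : 1 ≤ 1 + (1 + s) ^ 2 := by nlinarith [sq_nonneg (1 + s)]
  have h1 : (1 + (1 + s) ^ 2) ^ (-(μ / 2) - 1) ≤ (1 + (1 + s) ^ 2) ^ (-1 : ℝ) :=
    Real.rpow_le_rpow_of_exponent_le hx (by linarith)
  rw [Real.rpow_neg_one] at h1
  have h2 : |1 + s| ≤ 1 + (1 + s) ^ 2 := by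
    rw [← sq_abs]; nlinarith [sq_nonneg (|1 + s| - 1), abs_nonneg (1 + s)]
  have h0 : 0 ≤ (1 + (1 + s) ^ 2) ^ (-(μ / 2) - 1) := Real.rpow_nonneg (by linarith) _
  rw [profileDeriv, abs_neg, abs_mul, abs_mul, abs_of_nonneg hμ, abs_of_nonneg h0, mul_assoc]
  refine mul_le_of_le_one_right hμ ?_
  calc |1 + s| * (1 + (1 + s) ^ 2) ^ (-(μ / 2) - 1)
      ≤ (1 + (1 + s) ^ 2) * (1 + (1 + s) ^ 2)⁻¹ := by gcongr
    _ = 1 := mul_inv_cancel₀ (by positivity)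

theorem le_neg_profileDeriv {μ s : ℝ} (hμ : 0 ≤ μ) (hs : 0 ≤ s) :
    μ * 2 ^ (-(μ / 2) - 1) * (1 + s) ^ (-(1 + μ)) ≤ -profileDeriv μ s := by
  have h1 : (2 * (1 + s) ^ 2) ^ (-(μ / 2) - 1) ≤ (1 + (1 + s) ^ 2) ^ (-(μ / 2) - 1) :=
    Real.rpow_le_rpow_of_nonpos (by positivity) (by nlinarith) (by linarith)
  have h2 : (2 * (1 + s) ^ 2) ^ (-(μ / 2) - 1) * (1 + s)
      = 2 ^ (-(μ / 2) - 1) * (1 + s) ^ (-(1 + μ)) := by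
    have hs1 : 0 < 1 + s := by linarith
    rw [Real.mul_rpow (by norm_num) (by positivity), mul_assoc, ← Real.rpow_natCast (1 + s) 2,
      ← Real.rpow_mul hs1.le, ← Real.rpow_add_one hs1.ne']
    congr 2; push_cast; ring
  unfold profileDeriv
  rw [neg_neg]
  calc _ = μ * ((2 * (1 + s) ^ 2) ^ (-(μ / 2) - 1) * (1 + s)) := by rw [h2]; ring
    _ ≤ μ * ((1 + (1 + s) ^ 2) ^ (-(μ / 2) - 1) * (1 + s)) := by gcongr
    _ = _ := by ring

/-! ### The coefficient form -/

section CoeffForm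

variable {n : ℕ} {a : SpaceTime n → Matrix (Fin n) (Fin n) ℝ} {p : SpaceTime n}

theorem coeffForm_add_left (ξ ξ' η : EuclideanSpace ℝ (Fin n)) :
    coeffForm a p (ξ + ξ') η = coeffForm a p ξ η + coeffForm a p ξ' η := by
  simp only [coeffForm, ← Finset.sum_add_distrib, PiLp.add_apply]
  exact Finset.sum_congr rfl fun i _ => Finset.sum_congr rfl fun j _ => by ring

theorem coeffForm_smul_left (r : ℝ) (ξ η : EuclideanSpace ℝ (Fin n)) :
    coeffForm a p (r • ξ) η = r * coeffForm a p ξ η := by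
  simp only [coeffForm, Finset.mul_sum, PiLp.smul_apply, smul_eq_mul]
  exact Finset.sum_congr rfl fun i _ => Finset.sum_congr rfl fun j _ => by ring

theorem coeffForm_add_right (ξ η η' : EuclideanSpace ℝ (Fin n)) :
    coeffForm a p ξ (η + η') = coeffForm a p ξ η + coeffForm a p ξ η' := by
  simp only [coeffForm, ← Finset.sum_add_distrib, PiLp.add_apply]
  exact Finset.sum_congr rfl fun i _ => Finset.sum_congr rfl fun j _ => by ring

theorem coeffForm_smul_right (r : ℝ) (ξ η : EuclideanSpace ℝ (Fin n)) :
    coeffForm a p ξ (r • η) = r * coeffForm a p ξ η := by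
  simp only [coeffForm, Finset.mul_sum, PiLp.smul_apply, smul_eq_mul]
  exact Finset.sum_congr rfl fun i _ => Finset.sum_congr rfl fun j _ => by ring

theorem coeffForm_sub_left (ξ ξ' η : EuclideanSpace ℝ (Fin n)) :
    coeffForm a p (ξ - ξ') η = coeffForm a p ξ η - coeffForm a p ξ' η := by
  rw [sub_eq_add_neg, ← neg_one_smul ℝ ξ', coeffForm_add_left, coeffForm_smul_left]; ring

theorem coeffForm_sub_right (ξ η η' : EuclideanSpace ℝ (Fin n)) :
    coeffForm a p ξ (η - η') = coeffForm a p ξ η - coeffForm a p ξ η' := by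
  rw [sub_eq_add_neg, ← neg_one_smul ℝ η', coeffForm_add_right, coeffForm_smul_right]; ring

theorem coeffForm_zero_left (η : EuclideanSpace ℝ (Fin n)) : coeffForm a p 0 η = 0 := by
  simp [coeffForm]

theorem coeffForm_comm (h : ∀ i j, a p i j = a p j i) (ξ η : EuclideanSpace ℝ (Fin n)) :
    coeffForm a p ξ η = coeffForm a p η ξ := by
  rw [coeffForm, Finset.sum_comm]
  exact Finset.sum_congr rfl fun i _ => Finset.sum_congr rfl fun j _ => by rw [h]; ring

theorem coeffForm_add_smul_self (h : ∀ i j, a p i j = a p j i) (t : ℝ)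
    (ξ η : EuclideanSpace ℝ (Fin n)) : coeffForm a p (ξ + t • η) (ξ + t • η)
      = coeffForm a p ξ ξ + 2 * t * coeffForm a p ξ η + t ^ 2 * coeffForm a p η η := by
  rw [coeffForm_add_left, coeffForm_add_right, coeffForm_add_right, coeffForm_smul_left,
    coeffForm_smul_left, coeffForm_smul_right, coeffForm_smul_right, coeffForm_comm h η ξ]
  ring

/-- Cauchy–Schwarz for the coefficient form. -/
theorem abs_coeffForm_le (h : ∀ i j, a p i j = a p j i) (h0 : ∀ ξ, 0 ≤ coeffForm a p ξ ξ)
    (ξ η : EuclideanSpace ℝ (Fin n)) :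
    |coeffForm a p ξ η| ≤ √(coeffForm a p ξ ξ) * √(coeffForm a p η η) := by
  have hd : discrim (coeffForm a p η η) (2 * coeffForm a p ξ η) (coeffForm a p ξ ξ) ≤ 0 := by
    refine discrim_le_zero fun t => ?_
    have := h0 (ξ + t • η)
    rw [coeffForm_add_smul_self h] at this
    linarith
  rw [← Real.sqrt_mul (h0 ξ)]
  refine Real.abs_le_sqrt ?_
  rw [discrim] at hd
  linarith

/-- Weighted Young inequality for the coefficient form. -/
theorem mul_coeffForm_le (h : ∀ i j, a p i j = a p j i) (h0 : ∀ ξ, 0 ≤ coeffForm a p ξ ξ)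
    {d : ℝ} (hd : 0 < d) (s : ℝ) (ξ η : EuclideanSpace ℝ (Fin n)) :
    s * coeffForm a p ξ η - d * coeffForm a p η η ≤ s ^ 2 / (4 * d) * coeffForm a p ξ ξ := by
  have := h0 (s • ξ + (-(2 * d)) • η)
  rw [coeffForm_add_smul_self h, coeffForm_smul_left, coeffForm_smul_left,
    coeffForm_smul_right] at this
  rw [div_mul_eq_mul_div, le_div_iff₀ (by positivity)]
  nlinarith

theorem abs_coeffForm_le_add (h : ∀ i j, a p i j = a p j i) (h0 : ∀ ξ, 0 ≤ coeffForm a p ξ ξ)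
    (ξ η : EuclideanSpace ℝ (Fin n)) :
    |coeffForm a p ξ η| ≤ coeffForm a p ξ ξ + coeffForm a p η η := by
  refine (abs_coeffForm_le h h0 ξ η).trans ?_
  nlinarith [Real.sq_sqrt (h0 ξ), Real.sq_sqrt (h0 η), sq_nonneg (√(coeffForm a p ξ ξ) -
    √(coeffForm a p η η)), sq_nonneg (√(coeffForm a p ξ ξ) + √(coeffForm a p η η))]

theorem coeffForm_add_le (h : ∀ i j, a p i j = a p j i) (h0 : ∀ ξ, 0 ≤ coeffForm a p ξ ξ)
    (ξ η : EuclideanSpace ℝ (Fin n)) : coeffForm a p (ξ + η) (ξ + η)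
      ≤ 2 * coeffForm a p ξ ξ + 2 * coeffForm a p η η := by
  have h1 := h0 (ξ + (-1 : ℝ) • η)
  have h2 := coeffForm_add_smul_self h 1 ξ η
  rw [coeffForm_add_smul_self h] at h1
  rw [one_smul] at h2
  linarith

theorem coeffForm_sub_le (h : ∀ i j, a p i j = a p j i) (h0 : ∀ ξ, 0 ≤ coeffForm a p ξ ξ)
    (ξ η : EuclideanSpace ℝ (Fin n)) : coeffForm a p (ξ - η) (ξ - η)
      ≤ 2 * coeffForm a p ξ ξ + 2 * coeffForm a p η η := by
  have h1 := h0 (ξ + (1 : ℝ) • η)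
  have h2 := coeffForm_add_smul_self h (-1) ξ η
  rw [coeffForm_add_smul_self h] at h1
  rw [neg_one_smul, ← sub_eq_add_neg] at h2
  linarith

end CoeffForm

section Operator

variable {n : ℕ} {a : SpaceTime n → Matrix (Fin n) (Fin n) ℝ} {A : SpaceTime n → ℝ}

theorem IsDivFormOperator.ae_symm (hL : IsDivFormOperator a A) :
    ∀ᵐ p : SpaceTime n, ∀ i j, a p i j = a p j i :=
  ae_all_iff.2 fun i => ae_all_iff.2 fun j => hL.coeff_symm i j

theorem IsDivFormOperator.aemeasurable_coeffForm (hL : IsDivFormOperator a A)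
    {Ω : Set (SpaceTime n)} {X Y : SpaceTime n → EuclideanSpace ℝ (Fin n)}
    (hX : AEMeasurable X (volume.restrict Ω)) (hY : AEMeasurable Y (volume.restrict Ω)) :
    AEMeasurable (fun p => coeffForm a p (X p) (Y p)) (volume.restrict Ω) := by
  have hc : ∀ i, Measurable fun x : EuclideanSpace ℝ (Fin n) => x i := fun i =>
    (EuclideanSpace.proj (𝕜 := ℝ) i).continuous.measurable
  unfold coeffForm
  refine Finset.aemeasurable_fun_sum _ fun i _ => Finset.aemeasurable_fun_sum _ fun j _ => ?_
  exact ((hL.coeff_measurable i j).restrict.mul ((hc i).comp_aemeasurable hX)).mul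
    ((hc j).comp_aemeasurable hY)

end Operator

/-! ### Classical derivatives -/

section Derivatives

variable {n : ℕ} {Ω : Set (SpaceTime n)} {f g : SpaceTime n → ℝ} {p : SpaceTime n}

theorem timeDeriv_mul (hf : DifferentiableAt ℝ f p) (hg : DifferentiableAt ℝ g p) :
    timeDeriv (fun p => f p * g p) p = f p * timeDeriv g p + g p * timeDeriv f p := by
  simp [timeDeriv, fderiv_fun_mul hf hg]

theorem spaceGrad_mul (hf : DifferentiableAt ℝ f p) (hg : DifferentiableAt ℝ g p) :
    spaceGrad (fun p => f p * g p) p = f p • spaceGrad g p + g p • spaceGrad f p := by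
  ext i; simp [spaceGrad, fderiv_fun_mul hf hg]

theorem timeDeriv_sub (hf : DifferentiableAt ℝ f p) (hg : DifferentiableAt ℝ g p) :
    timeDeriv (fun p => f p - g p) p = timeDeriv f p - timeDeriv g p := by
  simp [timeDeriv, fderiv_fun_sub hf hg]

theorem spaceGrad_sub (hf : DifferentiableAt ℝ f p) (hg : DifferentiableAt ℝ g p) :
    spaceGrad (fun p => f p - g p) p = spaceGrad f p - spaceGrad g p := by
  ext i; simp [spaceGrad, fderiv_fun_sub hf hg]

theorem fderiv_comp_real {h : ℝ → ℝ} {h' : ℝ} (hh : HasDerivAt h h' (f p))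
    (hf : DifferentiableAt ℝ f p) : fderiv ℝ (fun p => h (f p)) p = h' • fderiv ℝ f p :=
  (hh.comp_hasFDerivAt p hf.hasFDerivAt).fderiv

theorem timeDeriv_comp {h : ℝ → ℝ} {h' : ℝ} (hh : HasDerivAt h h' (f p))
    (hf : DifferentiableAt ℝ f p) : timeDeriv (fun p => h (f p)) p = h' * timeDeriv f p := by
  simp [timeDeriv, fderiv_comp_real hh hf]

theorem spaceGrad_comp {h : ℝ → ℝ} {h' : ℝ} (hh : HasDerivAt h h' (f p))
    (hf : DifferentiableAt ℝ f p) : spaceGrad (fun p => h (f p)) p = h' • spaceGrad f p := by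
  ext i; simp [spaceGrad, fderiv_comp_real hh hf]

theorem continuousOn_timeDeriv (hΩ : IsOpen Ω) (hf : ContDiffOn ℝ ∞ f Ω) :
    ContinuousOn (timeDeriv f) Ω :=
  (hf.continuousOn_fderiv_of_isOpen hΩ (by simp)).clm_apply continuousOn_const

theorem continuousOn_spaceGrad (hΩ : IsOpen Ω) (hf : ContDiffOn ℝ ∞ f Ω) :
    ContinuousOn (spaceGrad f) Ω := by
  have h : ContinuousOn (fun p => fun i : Fin n => fderiv ℝ f p (0, EuclideanSpace.single i 1)) Ω :=
    continuousOn_pi.2 fun i =>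
      (hf.continuousOn_fderiv_of_isOpen hΩ (by simp)).clm_apply continuousOn_const
  exact (PiLp.continuous_toLp 2 _).comp_continuousOn h

theorem timeDeriv_eq_zero_of_notMem_tsupport (hp : p ∉ tsupport f) : timeDeriv f p = 0 := by
  simp [timeDeriv, fderiv_of_notMem_tsupport (𝕜 := ℝ) hp]

theorem spaceGrad_eq_zero_of_notMem_tsupport (hp : p ∉ tsupport f) : spaceGrad f p = 0 := by
  ext i; simp [spaceGrad, fderiv_of_notMem_tsupport (𝕜 := ℝ) hp]

/-- The time derivative of a test function has integral zero. -/
theorem integral_timeDeriv_eq_zero (hf : ContDiff ℝ ∞ f) (hc : HasCompactSupport f) :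
    ∫ p, timeDeriv f p = 0 := by
  have h1 : Integrable (fun p => (1 : ℝ) * fderiv ℝ f p (1, 0)) := by
    simp only [one_mul]
    exact ((hf.continuous_fderiv (by simp)).clm_apply
      continuous_const).integrable_of_hasCompactSupport (hc.fderiv_apply (𝕜 := ℝ) _)
  have : (volume : Measure (SpaceTime n)).IsAddHaarMeasure := by
    rw [Measure.volume_eq_prod]; infer_instance
  have := integral_mul_fderiv_eq_neg_fderiv_mul_of_integrable (𝕜 := ℝ)
    (μ := (volume : Measure (SpaceTime n))) (f := fun _ => (1 : ℝ)) (g := f) (v := (1, 0))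
    (by simp) h1 (by simpa using hf.continuous.integrable_of_hasCompactSupport hc)
    (fun _ _ => differentiableAt_const _)
    (fun x _ => hf.differentiable (by simp) x)
  simpa [timeDeriv] using this

/-- A cut-off of a function that is smooth only on `Ω` is globally smooth. -/
theorem contDiff_mul_of_tsupport_subset (hΩ : IsOpen Ω) {ζ : SpaceTime n → ℝ}
    (hζ : ContDiff ℝ ∞ ζ) (hs : tsupport ζ ⊆ Ω) (hf : ContDiffOn ℝ ∞ f Ω) :
    ContDiff ℝ ∞ (fun p => ζ p * f p) := by
  refine contDiff_iff_contDiffAt.2 fun p => ?_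
  by_cases hp : p ∈ Ω
  · exact hζ.contDiffAt.mul (hf.contDiffAt (hΩ.mem_nhds hp))
  · have : (fun p => ζ p * f p) =ᶠ[𝓝 p] fun _ => 0 := by
      filter_upwards [(isClosed_tsupport ζ).isOpen_compl.mem_nhds fun h => hp (hs h)] with x hx
      rw [image_eq_zero_of_notMem_tsupport hx, zero_mul]
    exact contDiffAt_const.congr_of_eventuallyEq this

end Derivatives

/-! ### Elements of the completion -/

section Completion

variable {n : ℕ} {a : SpaceTime n → Matrix (Fin n) (Fin n) ℝ} {A : SpaceTime n → ℝ} {q : ℝ}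
  {Ω : Set (SpaceTime n)} {w wt w' wt' : SpaceTime n → ℝ}
  {G G' : SpaceTime n → EuclideanSpace ℝ (Fin n)} {f f' : ℕ → SpaceTime n → ℝ}

theorem lintegral_rpow_abs_eq_eLpNorm (hq : 1 < q) (w : SpaceTime n → ℝ) :
    (∫⁻ p in Ω, ENNReal.ofReal (|w p| ^ max 1 q)) ^ (1 / max 1 q)
      = eLpNorm w (ENNReal.ofReal q) (volume.restrict Ω) := by
  have h0 : 0 < q := by linarith
  rw [eLpNorm_eq_lintegral_rpow_enorm_toReal (by simpa using h0) ENNReal.ofReal_ne_top,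
    ENNReal.toReal_ofReal h0.le, max_eq_right hq.le]
  congr 1
  refine lintegral_congr fun p => ?_
  rw [← ENNReal.ofReal_rpow_of_nonneg (abs_nonneg _) h0.le, ← Real.norm_eq_abs,
    ofReal_norm]

/-- Smooth functions on `Ω` converging to `(w, wt, G)` in `L¹` together with their time
derivatives, and in energy; on a bounded `Ω` this is implied by convergence in the norm. -/
structure IsApprox (a : SpaceTime n → Matrix (Fin n) (Fin n) ℝ) (Ω : Set (SpaceTime n))
    (w wt : SpaceTime n → ℝ) (G : SpaceTime n → EuclideanSpace ℝ (Fin n))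
    (f : ℕ → SpaceTime n → ℝ) : Prop where
  smooth : ∀ k, ContDiffOn ℝ ∞ (f k) Ω
  time : Tendsto (fun k => ∫⁻ p in Ω, ‖wt p - timeDeriv (f k) p‖ₑ) atTop (𝓝 0)
  energy : Tendsto (fun k => ∫⁻ p in Ω, ENNReal.ofReal
    (coeffForm a p (G p - spaceGrad (f k) p) (G p - spaceGrad (f k) p))) atTop (𝓝 0)
  fn : Tendsto (fun k => ∫⁻ p in Ω, ‖w p - f k p‖ₑ) atTop (𝓝 0)

theorem MemW.exists_isApprox (hq : 1 < q) (hΩ : IsOpen Ω) (hb : Bornology.IsBounded Ω)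
    (h : MemW a q Ω w wt G) : ∃ f, IsApprox a Ω w wt G f := by
  obtain ⟨f, hf, -, hlim⟩ := h.exists_approx
  have hle : ∀ {x : ℕ → ENNReal}, (∀ k, x k ≤ sobolevNorm a q Ω (fun p => w p - f k p)
      (fun p => wt p - timeDeriv (f k) p) (fun p => G p - spaceGrad (f k) p)) →
      Tendsto x atTop (𝓝 0) := fun hx =>
    tendsto_of_tendsto_of_tendsto_of_le_of_le tendsto_const_nhds hlim (fun _ => zero_le) hx
  refine ⟨f, hf, ?_, ?_, ?_⟩
  · refine hle fun k => ?_
    simp only [sobolevNorm, ← Real.norm_eq_abs, ofReal_norm, add_assoc]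
    exact le_self_add
  · have h1 := hle (x := fun k => (∫⁻ p in Ω, ENNReal.ofReal
      (coeffForm a p (G p - spaceGrad (f k) p) (G p - spaceGrad (f k) p))) ^ (1 / 2 : ℝ))
      fun k => by
        simp only [sobolevNorm]
        exact le_add_right le_add_self
    have h2 := h1.ennrpow_const 2
    simpa only [← ENNReal.rpow_mul, show (1 / 2 : ℝ) * 2 = 1 by norm_num, ENNReal.rpow_one,
      ENNReal.zero_rpow_of_pos two_pos] using h2
  · have hq0 : (1 : ENNReal) ≤ ENNReal.ofReal q := by
      rw [← ENNReal.ofReal_one]; exact ENNReal.ofReal_le_ofReal hq.le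
    have h1 : Tendsto (fun k => eLpNorm (fun p => w p - f k p) (ENNReal.ofReal q)
        (volume.restrict Ω)) atTop (𝓝 0) := hle fun k => by
      simp only [sobolevNorm, lintegral_rpow_abs_eq_eLpNorm hq]
      exact le_add_self
    have hfin : (volume.restrict Ω) Set.univ ≠ ⊤ := by
      rw [Measure.restrict_apply_univ]; exact hb.measure_lt_top.ne
    have h2 := ENNReal.Tendsto.mul_const h1 (Or.inr (ENNReal.rpow_ne_top_of_nonneg
      (y := 1 / (1 : ENNReal).toReal - 1 / (ENNReal.ofReal q).toReal) (by
        rw [ENNReal.toReal_ofReal (by linarith)]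
        simpa using inv_le_one_of_one_le₀ hq.le) hfin))
    rw [zero_mul] at h2
    refine tendsto_of_tendsto_of_tendsto_of_le_of_le tendsto_const_nhds h2
      (fun _ => zero_le) fun k => ?_
    have := eLpNorm_le_eLpNorm_mul_rpow_measure_univ (f := fun p => w p - f k p) hq0
      (h.aemeasurable.sub ((hf k).continuousOn.aemeasurable
        hΩ.measurableSet)).aestronglyMeasurable
    rwa [eLpNorm_one_eq_lintegral_enorm] at this

theorem IsApprox.sub (hL : IsDivFormOperator a A) (hΩ : IsOpen Ω)
    (hwt : AEMeasurable wt (volume.restrict Ω)) (hG : AEMeasurable G (volume.restrict Ω))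
    (hw : AEMeasurable w (volume.restrict Ω))
    (h : IsApprox a Ω w wt G f) (h' : IsApprox a Ω w' wt' G' f') :
    IsApprox a Ω (fun p => w p - w' p) (fun p => wt p - wt' p) (fun p => G p - G' p)
      (fun k p => f k p - f' k p) := by
  have hd : ∀ k, ∀ p ∈ Ω, DifferentiableAt ℝ (f k) p := fun k p hp =>
    ((h.smooth k).contDiffAt (hΩ.mem_nhds hp)).differentiableAt (by simp)
  have hd' : ∀ k, ∀ p ∈ Ω, DifferentiableAt ℝ (f' k) p := fun k p hp =>
    ((h'.smooth k).contDiffAt (hΩ.mem_nhds hp)).differentiableAt (by simp)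
  refine ⟨fun k => (h.smooth k).sub (h'.smooth k), ?_, ?_, ?_⟩
  · have hs := h.time.add h'.time
    rw [add_zero] at hs
    refine tendsto_of_tendsto_of_tendsto_of_le_of_le tendsto_const_nhds hs
      (fun _ => zero_le) fun k => ?_
    simp only
    have hm : AEMeasurable (fun p => wt p - timeDeriv (f k) p) (volume.restrict Ω) :=
      hwt.sub ((continuousOn_timeDeriv hΩ (h.smooth k)).aemeasurable hΩ.measurableSet)
    rw [← lintegral_add_left' hm.enorm]
    refine setLIntegral_mono' hΩ.measurableSet fun p hp => ?_
    rw [timeDeriv_sub (hd k p hp) (hd' k p hp), sub_sub_sub_comm]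
    exact enorm_sub_le
  · have hs := (ENNReal.Tendsto.const_mul h.energy (Or.inr (ENNReal.ofNat_ne_top (n := 2)))).add
      (ENNReal.Tendsto.const_mul h'.energy (Or.inr (ENNReal.ofNat_ne_top (n := 2))))
    rw [mul_zero, add_zero] at hs
    refine tendsto_of_tendsto_of_tendsto_of_le_of_le tendsto_const_nhds hs
      (fun _ => zero_le) fun k => ?_
    simp only
    have hm : AEMeasurable (fun p => G p - spaceGrad (f k) p) (volume.restrict Ω) :=
      hG.sub ((continuousOn_spaceGrad hΩ (h.smooth k)).aemeasurable hΩ.measurableSet)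
    rw [← lintegral_const_mul' _ _ ENNReal.ofNat_ne_top,
      ← lintegral_const_mul' _ _ ENNReal.ofNat_ne_top,
      ← lintegral_add_left' ((hL.aemeasurable_coeffForm hm hm).ennreal_ofReal.const_mul _)]
    refine lintegral_mono_ae ?_
    filter_upwards [ae_restrict_mem hΩ.measurableSet, ae_restrict_of_ae hL.ae_symm,
      ae_restrict_of_ae hL.form_nonneg] with p hp h1 h2
    rw [spaceGrad_sub (hd k p hp) (hd' k p hp), sub_sub_sub_comm]
    refine (ENNReal.ofReal_le_ofReal (coeffForm_sub_le h1 h2 _ _)).trans ?_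
    rw [ENNReal.ofReal_add (by have := h2 (G p - spaceGrad (f k) p); positivity)
      (by have := h2 (G' p - spaceGrad (f' k) p); positivity),
      ENNReal.ofReal_mul (by norm_num), ENNReal.ofReal_mul (by norm_num), ENNReal.ofReal_ofNat]
  · have hs := h.fn.add h'.fn
    rw [add_zero] at hs
    refine tendsto_of_tendsto_of_tendsto_of_le_of_le tendsto_const_nhds hs
      (fun _ => zero_le) fun k => ?_
    simp only
    have hm : AEMeasurable (fun p => w p - f k p) (volume.restrict Ω) :=
      hw.sub ((h.smooth k).continuousOn.aemeasurable hΩ.measurableSet)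
    rw [← lintegral_add_left' hm.enorm]
    refine setLIntegral_mono' hΩ.measurableSet fun p hp => ?_
    rw [sub_sub_sub_comm]
    exact enorm_sub_le

theorem IsApprox.exists_ae_tendsto (hΩ : IsOpen Ω) (hw : AEMeasurable w (volume.restrict Ω))
    (h : IsApprox a Ω w wt G f) : ∃ g, IsApprox a Ω w wt G g ∧
      ∀ᵐ p ∂volume.restrict Ω, Tendsto (fun k => g k p) atTop (𝓝 (w p)) := by
  have hfm : ∀ k, AEStronglyMeasurable (f k) (volume.restrict Ω) := fun k =>
    ((h.smooth k).continuousOn.aemeasurable hΩ.measurableSet).aestronglyMeasurable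
  have h1 : TendstoInMeasure (volume.restrict Ω) f atTop w := by
    refine tendstoInMeasure_of_tendsto_eLpNorm one_ne_zero hfm hw.aestronglyMeasurable ?_
    simp only [eLpNorm_one_eq_lintegral_enorm]
    refine h.fn.congr fun k => lintegral_congr fun p => ?_
    rw [Pi.sub_apply, enorm_sub_rev]
  obtain ⟨ns, hns, hlim⟩ := h1.exists_seq_tendsto_ae
  exact ⟨fun k => f (ns k), ⟨fun k => h.smooth _, h.time.comp hns.tendsto_atTop,
    h.energy.comp hns.tendsto_atTop, h.fn.comp hns.tendsto_atTop⟩, hlim⟩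

theorem MemW.exists_sobolevNorm_lt_top (h : MemW a q Ω w wt G) :
    ∃ f, ContDiffOn ℝ ∞ f Ω ∧ sobolevNorm a q Ω f (timeDeriv f) (spaceGrad f) < ⊤ ∧
      sobolevNorm a q Ω (fun p => w p - f p) (fun p => wt p - timeDeriv f p)
        (fun p => G p - spaceGrad f p) < ⊤ := by
  obtain ⟨f, hf, hfin, hlim⟩ := h.exists_approx
  obtain ⟨k, hk⟩ := (hlim.eventually (gt_mem_nhds ENNReal.zero_lt_top)).exists
  exact ⟨f k, hf k, hfin k, hk⟩

theorem MemW.integrableOn_time (hΩ : IsOpen Ω) (h : MemW a q Ω w wt G) : IntegrableOn wt Ω := by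
  obtain ⟨f, hf, h1, h2⟩ := h.exists_sobolevNorm_lt_top
  simp only [sobolevNorm, ENNReal.add_lt_top, ← Real.norm_eq_abs, ofReal_norm] at h1 h2
  have hm := (continuousOn_timeDeriv hΩ hf).aemeasurable (μ := volume) hΩ.measurableSet
  have i1 : IntegrableOn (timeDeriv f) Ω := ⟨hm.aestronglyMeasurable, h1.1.1⟩
  have i2 : IntegrableOn (fun p => wt p - timeDeriv f p) Ω :=
    ⟨(h.aemeasurable_time.sub hm).aestronglyMeasurable, h2.1.1⟩
  refine (i2.add i1).congr (ae_of_all _ fun p => ?_)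
  simp

theorem MemW.memLp (hq : 1 < q) (hΩ : IsOpen Ω) (h : MemW a q Ω w wt G) :
    MemLp w (ENNReal.ofReal q) (volume.restrict Ω) := by
  obtain ⟨f, hf, h1, h2⟩ := h.exists_sobolevNorm_lt_top
  simp only [sobolevNorm, ENNReal.add_lt_top, lintegral_rpow_abs_eq_eLpNorm hq] at h1 h2
  have hm := hf.continuousOn.aemeasurable (μ := volume) hΩ.measurableSet
  have i1 : MemLp f (ENNReal.ofReal q) (volume.restrict Ω) := ⟨hm.aestronglyMeasurable, h1.2⟩
  have i2 : MemLp (fun p => w p - f p) (ENNReal.ofReal q) (volume.restrict Ω) :=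
    ⟨(h.aemeasurable.sub hm).aestronglyMeasurable, h2.2⟩
  refine (memLp_congr_ae (ae_of_all _ fun p => ?_)).1 (i2.add i1)
  simp

theorem integrableOn_abs_rpow_of_memLp (hq : 1 < q)
    (h : MemLp w (ENNReal.ofReal q) (volume.restrict Ω)) :
    IntegrableOn (fun p => |w p| ^ q) Ω := by
  have := h.integrable_norm_rpow (by simp; linarith) ENNReal.ofReal_ne_top
  rwa [ENNReal.toReal_ofReal (by linarith)] at this

theorem MemW.integrableOn_energy (hL : IsDivFormOperator a A) (hΩ : IsOpen Ω)
    (h : MemW a q Ω w wt G) : IntegrableOn (fun p => coeffForm a p (G p) (G p)) Ω := by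
  obtain ⟨f, hf, h1, h2⟩ := h.exists_sobolevNorm_lt_top
  simp only [sobolevNorm, ENNReal.add_lt_top,
    ENNReal.rpow_lt_top_iff_of_pos (show (0 : ℝ) < 1 / 2 by norm_num)] at h1 h2
  have hm := (continuousOn_spaceGrad hΩ hf).aemeasurable (μ := volume) hΩ.measurableSet
  have hm' := h.aemeasurable_grad.sub hm
  have hpos : ∀ X : SpaceTime n → EuclideanSpace ℝ (Fin n),
      0 ≤ᵐ[volume.restrict Ω] fun p => coeffForm a p (X p) (X p) := fun X => by
    filter_upwards [ae_restrict_of_ae hL.form_nonneg] with p hp using hp _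
  have i1 : IntegrableOn (fun p => coeffForm a p (spaceGrad f p) (spaceGrad f p)) Ω :=
    ⟨(hL.aemeasurable_coeffForm hm hm).aestronglyMeasurable,
      (hasFiniteIntegral_iff_ofReal (hpos _)).2 h1.1.2⟩
  have i2 : IntegrableOn (fun p => coeffForm a p (G p - spaceGrad f p) (G p - spaceGrad f p)) Ω :=
    ⟨(hL.aemeasurable_coeffForm hm' hm').aestronglyMeasurable,
      (hasFiniteIntegral_iff_ofReal (hpos _)).2 h2.1.2⟩
  refine ((i2.const_mul 2).add (i1.const_mul 2)).mono'
    (hL.aemeasurable_coeffForm h.aemeasurable_grad h.aemeasurable_grad).aestronglyMeasurable ?_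
  filter_upwards [ae_restrict_of_ae hL.ae_symm, ae_restrict_of_ae hL.form_nonneg] with p hs hp
  have := coeffForm_add_le hs hp (G p - spaceGrad f p) (spaceGrad f p)
  rw [sub_add_cancel] at this
  rwa [Real.norm_of_nonneg (hp _)]

end Completion

/-! ### Testing the inequality with functions of the solution -/

section WeakInequality

variable {n : ℕ} {a : SpaceTime n → Matrix (Fin n) (Fin n) ℝ} {A : SpaceTime n → ℝ} {q : ℝ}
  {Ω : Set (SpaceTime n)} {w wt u ut v vt : SpaceTime n → ℝ}
  {G Gu Gv : SpaceTime n → EuclideanSpace ℝ (Fin n)} {φ ζ : SpaceTime n → ℝ}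

theorem exists_abs_le_of_hasCompactSupport (hφ : Continuous φ) (hc : HasCompactSupport φ) :
    ∃ M : ℝ, 0 ≤ M ∧ ∀ p, |φ p| ≤ M := by
  obtain ⟨M, hM⟩ := hc.exists_bound_of_continuous hφ
  exact ⟨M, (norm_nonneg _).trans (hM 0), hM⟩

theorem continuous_timeDeriv (hφ : ContDiff ℝ ∞ φ) : Continuous (timeDeriv φ) :=
  (hφ.continuous_fderiv (by simp)).clm_apply continuous_const

theorem continuous_spaceGrad (hφ : ContDiff ℝ ∞ φ) : Continuous (spaceGrad φ) :=
  continuousOn_univ.1 (continuousOn_spaceGrad isOpen_univ hφ.contDiffOn)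

theorem hasCompactSupport_timeDeriv (hc : HasCompactSupport φ) :
    HasCompactSupport (timeDeriv φ) := hc.fderiv_apply (𝕜 := ℝ) _

theorem integrableOn_coeffForm_spaceGrad (hL : IsDivFormOperator a A)
    (hb : Bornology.IsBounded Ω) (hφ : ContDiff ℝ ∞ φ) (hc : HasCompactSupport φ) :
    IntegrableOn (fun p => coeffForm a p (spaceGrad φ p) (spaceGrad φ p)) Ω := by
  obtain ⟨C, hC⟩ := hL.bound_locallyBounded _ hc
  obtain ⟨M, hM⟩ := hc.exists_bound_of_continuousOn (continuous_spaceGrad hφ).continuousOn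
  have hm : AEMeasurable (spaceGrad φ) (volume.restrict Ω) :=
    (continuous_spaceGrad hφ).measurable.aemeasurable
  have hfin : IsFiniteMeasure (volume.restrict Ω) :=
    isFiniteMeasure_restrict.2 hb.measure_lt_top.ne
  refine Integrable.of_bound (hL.aemeasurable_coeffForm hm hm).aestronglyMeasurable (|C| * M ^ 2) ?_
  filter_upwards [ae_restrict_of_ae hL.form_nonneg, ae_restrict_of_ae hL.form_le] with p h0 h1
  rw [Real.norm_of_nonneg (h0 _)]
  by_cases hp : p ∈ tsupport φ
  · refine (h1 _).trans (mul_le_mul ((le_abs_self _).trans ((hC p hp).trans (le_abs_self C))) ?_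
      (by positivity) (abs_nonneg _))
    exact pow_le_pow_left₀ (norm_nonneg _) (hM p hp) 2
  · rw [spaceGrad_eq_zero_of_notMem_tsupport hp, coeffForm_zero_left]
    positivity

theorem MemW.integrableOn_nonlinearity (hq : 1 < q) (hΩ : IsOpen Ω) (h : MemW a q Ω w wt G) :
    IntegrableOn (fun p => |w p| ^ (q - 1) * w p) Ω := by
  refine (integrableOn_abs_rpow_of_memLp hq (h.memLp hq hΩ)).mono' ?_ (ae_of_all _ fun p => ?_)
  · exact ((h.aemeasurable.abs.pow_const _).mul h.aemeasurable).aestronglyMeasurable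
  · rw [norm_mul, Real.norm_of_nonneg (Real.rpow_nonneg (abs_nonneg _) _), Real.norm_eq_abs,
      rpow_sub_one_mul_self (abs_nonneg _) hq]

theorem MemW.integrableOn_weakForm (hL : IsDivFormOperator a A) (hq : 1 < q) (hΩ : IsOpen Ω)
    (hb : Bornology.IsBounded Ω) (h : MemW a q Ω w wt G) (hφ : ContDiff ℝ ∞ φ)
    (hc : HasCompactSupport φ) :
    IntegrableOn (fun p => wt p * φ p + coeffForm a p (spaceGrad φ p) (G p)
      - |w p| ^ (q - 1) * w p * φ p) Ω := by
  obtain ⟨M, -, hM⟩ := exists_abs_le_of_hasCompactSupport hφ.continuous hc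
  have hm : AEMeasurable (spaceGrad φ) (volume.restrict Ω) :=
    (continuous_spaceGrad hφ).measurable.aemeasurable
  refine (((h.integrableOn_time hΩ).mul_bdd (c := M) hφ.continuous.aestronglyMeasurable
    (ae_of_all _ hM)).add ?_).sub ((h.integrableOn_nonlinearity hq hΩ).mul_bdd (c := M)
      hφ.continuous.aestronglyMeasurable (ae_of_all _ hM))
  refine ((integrableOn_coeffForm_spaceGrad hL hb hφ hc).add (h.integrableOn_energy hL hΩ)).mono'
    (hL.aemeasurable_coeffForm hm h.aemeasurable_grad).aestronglyMeasurable ?_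
  filter_upwards [ae_restrict_of_ae hL.ae_symm, ae_restrict_of_ae hL.form_nonneg] with p h1 h0
  exact abs_coeffForm_le_add h1 h0 _ _

theorem weakForm_eq_setIntegral (hs : tsupport φ ⊆ Ω) :
    weakForm a q w wt G φ = ∫ p in Ω, (wt p * φ p + coeffForm a p (spaceGrad φ p) (G p)
      - |w p| ^ (q - 1) * w p * φ p) := by
  refine (setIntegral_eq_integral_of_forall_compl_eq_zero fun p hp => ?_).symm
  have hp' : p ∉ tsupport φ := fun h => hp (hs h)
  rw [spaceGrad_eq_zero_of_notMem_tsupport hp', coeffForm_zero_left,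
    image_eq_zero_of_notMem_tsupport hp']
  ring

/-- If the energy of `X k` tends to zero, so does the integral of `a(X k, G)`. -/
theorem tendsto_lintegral_coeffForm (hL : IsDivFormOperator a A)
    {X : ℕ → SpaceTime n → EuclideanSpace ℝ (Fin n)}
    (hX : ∀ k, AEMeasurable (X k) (volume.restrict Ω)) (hG : AEMeasurable G (volume.restrict Ω))
    (hGi : IntegrableOn (fun p => coeffForm a p (G p) (G p)) Ω)
    (h : Tendsto (fun k => ∫⁻ p in Ω, ENNReal.ofReal (coeffForm a p (X k p) (X k p)))
      atTop (𝓝 0)) :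
    Tendsto (fun k => ∫⁻ p in Ω, ‖coeffForm a p (X k p) (G p)‖ₑ) atTop (𝓝 0) := by
  have hfin : (∫⁻ p in Ω, ENNReal.ofReal (coeffForm a p (G p) (G p))) ^ (1 / 2 : ℝ) ≠ ⊤ := by
    refine ENNReal.rpow_ne_top_of_nonneg (by norm_num) ?_
    refine ((hasFiniteIntegral_iff_ofReal ?_).1 hGi.2).ne
    filter_upwards [ae_restrict_of_ae hL.form_nonneg] with p hp using hp _
  have h1 := ENNReal.Tendsto.mul_const (h.ennrpow_const (1 / 2 : ℝ)) (Or.inr hfin)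
  rw [ENNReal.zero_rpow_of_pos (by norm_num), zero_mul] at h1
  refine tendsto_of_tendsto_of_tendsto_of_le_of_le tendsto_const_nhds h1
    (fun _ => zero_le) fun k => ?_
  have hsqrt : ∀ Y : SpaceTime n → EuclideanSpace ℝ (Fin n), AEMeasurable Y (volume.restrict Ω) →
      AEMeasurable (fun p => ENNReal.ofReal √(coeffForm a p (Y p) (Y p))) (volume.restrict Ω) :=
    fun Y hY => (hL.aemeasurable_coeffForm hY hY).sqrt.ennreal_ofReal
  have hsq : ∀ Y : SpaceTime n → EuclideanSpace ℝ (Fin n),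
      ∫⁻ p in Ω, ENNReal.ofReal √(coeffForm a p (Y p) (Y p)) ^ (2 : ℝ)
        = ∫⁻ p in Ω, ENNReal.ofReal (coeffForm a p (Y p) (Y p)) := fun Y => by
    refine lintegral_congr_ae ?_
    filter_upwards [ae_restrict_of_ae hL.form_nonneg] with p hp
    rw [ENNReal.ofReal_rpow_of_nonneg (Real.sqrt_nonneg _) zero_le_two, Real.rpow_two,
      Real.sq_sqrt (hp _)]
  have hH := ENNReal.lintegral_mul_le_Lp_mul_Lq (volume.restrict Ω) Real.HolderConjugate.two_two
    (hsqrt _ (hX k)) (hsqrt _ hG)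
  rw [hsq, hsq] at hH
  refine le_trans (lintegral_mono_ae ?_) hH
  filter_upwards [ae_restrict_of_ae hL.ae_symm, ae_restrict_of_ae hL.form_nonneg] with p h1 h0
  rw [Pi.mul_apply, ← ENNReal.ofReal_mul (Real.sqrt_nonneg _), ← ofReal_norm]
  exact ENNReal.ofReal_le_ofReal (abs_coeffForm_le h1 h0 _ _)

/-- The weak inequality for `u - v` may be tested with `ζ * g (u - v)`, although this function is
not smooth: it is the limit of the test functions `ζ * g (f k)` for smooth `f k` approximating
`u - v`. The time derivative is moved onto `ζ` through a primitive `H` of `g`. -/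
theorem weak_inequality_comp (hL : IsDivFormOperator a A) (hq : 1 < q) (hΩ : IsOpen Ω)
    (hb : Bornology.IsBounded Ω) (hu : MemW a q Ω u ut Gu) (hv : MemW a q Ω v vt Gv)
    (hweak : ∀ φ : SpaceTime n → ℝ, ContDiff ℝ ∞ φ → HasCompactSupport φ → (∀ p, 0 ≤ φ p) →
      weakForm a q v vt Gv φ ≤ weakForm a q u ut Gu φ)
    (hζ : ContDiff ℝ ∞ ζ) (hc : HasCompactSupport ζ) (hs : tsupport ζ ⊆ Ω) (hζ0 : ∀ p, 0 ≤ ζ p)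
    {g g' H : ℝ → ℝ} {M : ℝ} (hg : ContDiff ℝ ∞ g) (hH : ContDiff ℝ ∞ H)
    (hg' : ∀ s, HasDerivAt g (g' s) s) (hg'c : Continuous g') (hHg : ∀ s, HasDerivAt H (g s) s)
    (hg0 : ∀ s, 0 ≤ g s) (hgM : ∀ s, g s ≤ M) (hg'M : ∀ s, |g' s| ≤ M) :
    IntegrableOn (fun p => g (u p - v p) * coeffForm a p (spaceGrad ζ p) (Gu p - Gv p)
        + ζ p * g' (u p - v p) * coeffForm a p (Gu p - Gv p) (Gu p - Gv p)
        - (|u p| ^ (q - 1) * u p - |v p| ^ (q - 1) * v p) * (ζ p * g (u p - v p))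
        - timeDeriv ζ p * H (u p - v p)) Ω ∧
    0 ≤ ∫ p in Ω, (g (u p - v p) * coeffForm a p (spaceGrad ζ p) (Gu p - Gv p)
        + ζ p * g' (u p - v p) * coeffForm a p (Gu p - Gv p) (Gu p - Gv p)
        - (|u p| ^ (q - 1) * u p - |v p| ^ (q - 1) * v p) * (ζ p * g (u p - v p))
        - timeDeriv ζ p * H (u p - v p)) := by
  set μ := volume.restrict Ω
  have hfinm : IsFiniteMeasure μ := isFiniteMeasure_restrict.2 hb.measure_lt_top.ne
  have hM : 0 ≤ M := (hg0 0).trans (hgM 0)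
  obtain ⟨fu, hfu⟩ := hu.exists_isApprox hq hΩ hb
  obtain ⟨fv, hfv⟩ := hv.exists_isApprox hq hΩ hb
  set w : SpaceTime n → ℝ := fun p => u p - v p
  set wt : SpaceTime n → ℝ := fun p => ut p - vt p
  set G : SpaceTime n → EuclideanSpace ℝ (Fin n) := fun p => Gu p - Gv p
  set F : SpaceTime n → ℝ := fun p => |u p| ^ (q - 1) * u p - |v p| ^ (q - 1) * v p
  have hwm : AEMeasurable w μ := hu.aemeasurable.sub hv.aemeasurable
  have hGm : AEMeasurable G μ := hu.aemeasurable_grad.sub hv.aemeasurable_grad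
  obtain ⟨f, hf, hfae⟩ := (hfu.sub hL hΩ hu.aemeasurable_time hu.aemeasurable_grad
    hu.aemeasurable hfv).exists_ae_tendsto hΩ hwm
  have hq1 : (1 : ENNReal) ≤ ENNReal.ofReal q := by
    rw [← ENNReal.ofReal_one]; exact ENNReal.ofReal_le_ofReal hq.le
  have hwi : Integrable w μ := ((hu.memLp hq hΩ).sub (hv.memLp hq hΩ)).integrable hq1
  have hFi : Integrable F μ :=
    (hu.integrableOn_nonlinearity hq hΩ).sub (hv.integrableOn_nonlinearity hq hΩ)
  have hGi : Integrable (fun p => coeffForm a p (G p) (G p)) μ := by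
    refine (((hu.integrableOn_energy hL hΩ).const_mul 2).add
      ((hv.integrableOn_energy hL hΩ).const_mul 2)).mono'
      (hL.aemeasurable_coeffForm hGm hGm).aestronglyMeasurable ?_
    filter_upwards [ae_restrict_of_ae hL.ae_symm, ae_restrict_of_ae hL.form_nonneg] with p h1 h0
    rw [Real.norm_of_nonneg (h0 _)]
    exact coeffForm_sub_le h1 h0 _ _
  have hζGi := integrableOn_coeffForm_spaceGrad hL hb hζ hc
  have hζm : AEMeasurable (spaceGrad ζ) μ := (continuous_spaceGrad hζ).measurable.aemeasurable
  obtain ⟨M₁, hM₁, hζM⟩ := exists_abs_le_of_hasCompactSupport hζ.continuous hc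
  obtain ⟨M₂, hM₂, hζtM⟩ := exists_abs_le_of_hasCompactSupport (continuous_timeDeriv hζ)
    (hasCompactSupport_timeDeriv hc)
  have hHlip : ∀ x y, |H x - H y| ≤ M * |x - y| := fun x y =>
    Convex.norm_image_sub_le_of_norm_hasDerivWithin_le (s := Set.univ)
      (fun x _ => (hHg x).hasDerivWithinAt)
      (fun x _ => by rw [Real.norm_of_nonneg (hg0 x)]; exact hgM x) convex_univ trivial trivial
  have hfd : ∀ k, ∀ p ∈ Ω, DifferentiableAt ℝ (f k) p := fun k p hp =>
    ((hf.smooth k).contDiffAt (hΩ.mem_nhds hp)).differentiableAt (by simp)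
  have hfm : ∀ k, AEMeasurable (f k) μ := fun k =>
    (hf.smooth k).continuousOn.aemeasurable hΩ.measurableSet
  -- the integrand, apart from the time derivative, as a functional of the function inside `g`
  set X : (SpaceTime n → ℝ) → SpaceTime n → ℝ := fun h p =>
    g (h p) * coeffForm a p (spaceGrad ζ p) (G p) + ζ p * g' (h p) * coeffForm a p (G p) (G p)
      - F p * (ζ p * g (h p))
  set Y : SpaceTime n → ℝ := fun p => M * (coeffForm a p (spaceGrad ζ p) (spaceGrad ζ p)
    + coeffForm a p (G p) (G p)) + M₁ * M * coeffForm a p (G p) (G p) + |F p| * (M₁ * M)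
  have hYi : Integrable Y μ := (((hζGi.add hGi).const_mul M).add
    (hGi.const_mul (M₁ * M))).add (hFi.abs.mul_const _)
  have hXm : ∀ h : SpaceTime n → ℝ, AEMeasurable h μ → AEStronglyMeasurable (X h) μ :=
    fun h hh => by
      have hgh := hg.continuous.measurable.comp_aemeasurable hh
      refine AEMeasurable.aestronglyMeasurable ?_
      exact ((hgh.mul (hL.aemeasurable_coeffForm hζm hGm)).add
        ((hζ.continuous.measurable.aemeasurable.mul
          (hg'c.measurable.comp_aemeasurable hh)).mul (hL.aemeasurable_coeffForm hGm hGm))).sub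
        (hFi.aemeasurable.mul (hζ.continuous.measurable.aemeasurable.mul hgh))
  have hXY : ∀ h : SpaceTime n → ℝ, ∀ᵐ p ∂μ, ‖X h p‖ ≤ Y p := fun h => by
    filter_upwards [ae_restrict_of_ae hL.ae_symm, ae_restrict_of_ae hL.form_nonneg] with p h1 h0
    have hgh : |g (h p)| ≤ M := by rw [abs_of_nonneg (hg0 _)]; exact hgM _
    refine (abs_sub _ _).trans (add_le_add ((abs_add_le _ _).trans (add_le_add ?_ ?_)) ?_)
    · rw [abs_mul]
      exact mul_le_mul hgh (abs_coeffForm_le_add h1 h0 _ _) (abs_nonneg _) hM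
    · rw [abs_mul, abs_mul, abs_of_nonneg (h0 (G p))]
      exact mul_le_mul_of_nonneg_right (mul_le_mul (hζM p) (hg'M _) (abs_nonneg _) hM₁) (h0 _)
    · rw [abs_mul, abs_mul]
      exact mul_le_mul_of_nonneg_left (mul_le_mul (hζM p) hgh (abs_nonneg _) hM₁) (abs_nonneg _)
  have hXi : ∀ h : SpaceTime n → ℝ, AEMeasurable h μ → Integrable (X h) μ := fun h hh =>
    hYi.mono' (hXm h hh) (hXY h)
  have hXlim : Tendsto (fun k => ∫ p, X (f k) p ∂μ) atTop (𝓝 (∫ p, X w p ∂μ)) := by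
    refine tendsto_integral_of_dominated_convergence Y (fun k => hXm _ (hfm k)) hYi
      (fun k => hXY _) ?_
    filter_upwards [hfae] with p hp
    have h1 := (hg.continuous.tendsto (w p)).comp hp
    have h2 := (hg'c.tendsto (w p)).comp hp
    exact ((h1.mul_const _).add ((h2.const_mul _).mul_const _)).sub
      ((h1.const_mul _).const_mul _)
  set N : SpaceTime n → ℝ := fun p => timeDeriv ζ p * H (w p)
  have hNi : Integrable N μ := by
    have hHi : Integrable (fun p => H (w p)) μ := by
      refine ((integrable_const |H 0|).add (hwi.abs.const_mul M)).mono'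
        (hH.continuous.measurable.comp_aemeasurable hwm).aestronglyMeasurable
        (ae_of_all _ fun p => ?_)
      have h1 := hHlip (w p) 0
      rw [sub_zero] at h1
      have h2 := abs_add_le (H 0) (H (w p) - H 0)
      rw [add_sub_cancel] at h2
      exact h2.trans (add_le_add le_rfl h1)
    exact hHi.bdd_mul (c := M₂) (continuous_timeDeriv hζ).aestronglyMeasurable (ae_of_all _ hζtM)
  refine ⟨(hXi w hwm).sub hNi, ?_⟩
  -- the smooth test functions
  have hφ : ∀ k, ContDiff ℝ ∞ fun p => ζ p * g (f k p) := fun k =>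
    contDiff_mul_of_tsupport_subset hΩ hζ hs (hg.comp_contDiffOn (hf.smooth k))
  have hZ : ∀ k, ContDiff ℝ ∞ fun p => ζ p * H (f k p) := fun k =>
    contDiff_mul_of_tsupport_subset hΩ hζ hs (hH.comp_contDiffOn (hf.smooth k))
  have hφc : ∀ k, HasCompactSupport fun p => ζ p * g (f k p) := fun k => hc.mul_right
  have hZc : ∀ k, HasCompactSupport fun p => ζ p * H (f k p) := fun k => hc.mul_right
  have hφs : ∀ k, tsupport (fun p => ζ p * g (f k p)) ⊆ Ω := fun k =>
    (tsupport_mul_subset_left).trans hs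
  have hZs : ∀ k, tsupport (fun p => ζ p * H (f k p)) ⊆ Ω := fun k =>
    (tsupport_mul_subset_left).trans hs
  set Φ : ℕ → SpaceTime n → ℝ := fun k p =>
    (ut p * (ζ p * g (f k p)) + coeffForm a p (spaceGrad (fun p => ζ p * g (f k p)) p) (Gu p)
      - |u p| ^ (q - 1) * u p * (ζ p * g (f k p)))
    - (vt p * (ζ p * g (f k p)) + coeffForm a p (spaceGrad (fun p => ζ p * g (f k p)) p) (Gv p)
      - |v p| ^ (q - 1) * v p * (ζ p * g (f k p)))
    - timeDeriv (fun p => ζ p * H (f k p)) p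
  have hZi : ∀ k, Integrable (timeDeriv fun p => ζ p * H (f k p)) μ := fun k =>
    ((continuous_timeDeriv (hZ k)).integrable_of_hasCompactSupport
      (hasCompactSupport_timeDeriv (hZc k))).integrableOn
  have hui : ∀ k, _ := fun k => hu.integrableOn_weakForm hL hq hΩ hb (hφ k) (hφc k)
  have hvi : ∀ k, _ := fun k => hv.integrableOn_weakForm hL hq hΩ hb (hφ k) (hφc k)
  have hΦi : ∀ k, Integrable (Φ k) μ := fun k => ((hui k).sub (hvi k)).sub (hZi k)
  have hΦ0 : ∀ k, 0 ≤ ∫ p, Φ k p ∂μ := fun k => by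
    have h1 := hweak _ (hφ k) (hφc k) fun p => mul_nonneg (hζ0 p) (hg0 _)
    rw [weakForm_eq_setIntegral (hφs k), weakForm_eq_setIntegral (hφs k)] at h1
    have h2 : ∫ p, timeDeriv (fun p => ζ p * H (f k p)) p ∂μ = 0 := by
      rw [← integral_timeDeriv_eq_zero (hZ k) (hZc k)]
      exact setIntegral_eq_integral_of_forall_compl_eq_zero fun p hp =>
        timeDeriv_eq_zero_of_notMem_tsupport fun h => hp (hZs k h)
    have h3 : ∫ p, Φ k p ∂μ = _ := integral_sub ((hui k).sub (hvi k)) (hZi k)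
    rw [h3, h2, sub_zero]
    exact (sub_nonneg.2 h1).trans_eq (integral_sub (hui k) (hvi k)).symm
  -- the error committed in replacing `f k` by its limit
  set E : ℕ → SpaceTime n → ℝ := fun k p => Φ k p - (X (f k) p - N p)
  have hE : ∀ k, ∫⁻ p, ‖E k p‖ₑ ∂μ ≤ ENNReal.ofReal (M₁ * M) * ∫⁻ p, ‖wt p - timeDeriv (f k) p‖ₑ ∂μ
      + ENNReal.ofReal (M₂ * M) * ∫⁻ p, ‖w p - f k p‖ₑ ∂μ + ENNReal.ofReal (M₁ * M) *
        ∫⁻ p, ‖coeffForm a p (G p - spaceGrad (f k) p) (G p)‖ₑ ∂μ := fun k => by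
    have hm1 : AEMeasurable (fun p => wt p - timeDeriv (f k) p) μ :=
      (hu.aemeasurable_time.sub hv.aemeasurable_time).sub
        ((continuousOn_timeDeriv hΩ (hf.smooth k)).aemeasurable hΩ.measurableSet)
    have hm2 : AEMeasurable (fun p => w p - f k p) μ := hwm.sub (hfm k)
    have hm3 : AEMeasurable (fun p => ENNReal.ofReal (M₁ * M) * ‖wt p - timeDeriv (f k) p‖ₑ
        + ENNReal.ofReal (M₂ * M) * ‖w p - f k p‖ₑ) μ :=
      (hm1.enorm.const_mul _).add (hm2.enorm.const_mul _)
    rw [← lintegral_const_mul' _ _ ENNReal.ofReal_ne_top,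
      ← lintegral_const_mul' _ _ ENNReal.ofReal_ne_top,
      ← lintegral_const_mul' _ _ ENNReal.ofReal_ne_top,
      ← lintegral_add_left' (hm1.enorm.const_mul _),
      ← lintegral_add_left' hm3]
    refine setLIntegral_mono' hΩ.measurableSet fun p hp => ?_
    have hgf := hfd k p hp
    have hgd : DifferentiableAt ℝ (fun p => g (f k p)) p :=
      (hg' _).differentiableAt.comp p hgf
    have hHd : DifferentiableAt ℝ (fun p => H (f k p)) p :=
      (hHg _).differentiableAt.comp p hgf
    have hζd : DifferentiableAt ℝ ζ p := hζ.differentiable (by simp) p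
    have hEeq : E k p = ζ p * g (f k p) * (wt p - timeDeriv (f k) p)
        + timeDeriv ζ p * (H (w p) - H (f k p))
        - ζ p * g' (f k p) * coeffForm a p (G p - spaceGrad (f k) p) (G p) := by
      simp only [E, Φ, X, N, F, wt, G]
      rw [timeDeriv_mul hζd hHd, timeDeriv_comp (hHg _) hgf, spaceGrad_mul hζd hgd,
        spaceGrad_comp (hg' _) hgf]
      simp only [coeffForm_add_left, coeffForm_smul_left, coeffForm_sub_right,
        coeffForm_sub_left]
      ring
    have hgf' : |g (f k p)| ≤ M := by rw [abs_of_nonneg (hg0 _)]; exact hgM _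
    have hreal : ‖E k p‖ ≤ M₁ * M * ‖wt p - timeDeriv (f k) p‖ + M₂ * M * ‖w p - f k p‖
        + M₁ * M * ‖coeffForm a p (G p - spaceGrad (f k) p) (G p)‖ := by
      rw [hEeq]
      refine (abs_sub _ _).trans (add_le_add ((abs_add_le _ _).trans (add_le_add ?_ ?_)) ?_)
      · rw [abs_mul, abs_mul]
        exact mul_le_mul_of_nonneg_right (mul_le_mul (hζM p) hgf' (abs_nonneg _) hM₁)
          (abs_nonneg _)
      · rw [abs_mul, mul_assoc]
        exact mul_le_mul (hζtM p) (hHlip _ _) (abs_nonneg _) hM₂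
      · rw [abs_mul, abs_mul]
        exact mul_le_mul_of_nonneg_right (mul_le_mul (hζM p) (hg'M _) (abs_nonneg _) hM₁)
          (abs_nonneg _)
    rw [← ofReal_norm, ← ofReal_norm, ← ofReal_norm, ← ofReal_norm,
      ← ENNReal.ofReal_mul (by positivity), ← ENNReal.ofReal_mul (by positivity),
      ← ENNReal.ofReal_mul (by positivity), ← ENNReal.ofReal_add (by positivity) (by positivity),
      ← ENNReal.ofReal_add (by positivity) (by positivity)]
    exact ENNReal.ofReal_le_ofReal hreal
  have hElim : Tendsto (fun k => ∫ p, E k p ∂μ) atTop (𝓝 0) := by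
    have hen := tendsto_lintegral_coeffForm hL (fun k => hGm.sub
      ((continuousOn_spaceGrad hΩ (hf.smooth k)).aemeasurable hΩ.measurableSet)) hGm hGi hf.energy
    have hlim := ((ENNReal.Tendsto.const_mul hf.time
      (Or.inr (ENNReal.ofReal_ne_top (r := M₁ * M)))).add (ENNReal.Tendsto.const_mul hf.fn
      (Or.inr (ENNReal.ofReal_ne_top (r := M₂ * M))))).add (ENNReal.Tendsto.const_mul hen
      (Or.inr (ENNReal.ofReal_ne_top (r := M₁ * M))))
    simp only [mul_zero, add_zero] at hlim
    rw [tendsto_iff_enorm_sub_tendsto_zero]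
    refine tendsto_of_tendsto_of_tendsto_of_le_of_le tendsto_const_nhds hlim
      (fun _ => zero_le) fun k => ?_
    simp only [sub_zero]
    exact (enorm_integral_le_lintegral_enorm _).trans (hE k)
  have hk : ∀ k, 0 ≤ ∫ p, E k p ∂μ + (∫ p, X (f k) p ∂μ - ∫ p, N p ∂μ) := fun k => by
    have h1 : ∫ p, E k p ∂μ = ∫ p, Φ k p ∂μ - (∫ p, X (f k) p ∂μ - ∫ p, N p ∂μ) := by
      rw [← integral_sub (hXi _ (hfm k)) hNi]
      exact integral_sub (hΦi k) ((hXi _ (hfm k)).sub hNi)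
    rw [h1, sub_add_cancel]
    exact hΦ0 k
  have hfinal := ge_of_tendsto' (hElim.add (hXlim.sub_const _)) hk
  rw [zero_add, ← integral_sub (hXi w hwm) hNi] at hfinal
  exact hfinal

end WeakInequality

/-! ### Cut-off functions and boxes -/

section Cutoff

variable {n : ℕ}

/-- The open box `{|t| < τ, |x| < R}` in space-time. -/
def openBox (n : ℕ) (τ R : ℝ) : Set (SpaceTime n) := Metric.ball 0 τ ×ˢ Metric.ball 0 R

/-- The closed box `{|t| ≤ τ, |x| ≤ R}` in space-time. -/
def closedBox (n : ℕ) (τ R : ℝ) : Set (SpaceTime n) :=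
  Metric.closedBall 0 τ ×ˢ Metric.closedBall 0 R

theorem mem_closedBox {τ R : ℝ} {p : SpaceTime n} :
    p ∈ closedBox n τ R ↔ |p.1| ≤ τ ∧ ‖p.2‖ ≤ R := by
  simp [closedBox, Set.mem_prod]

theorem isOpen_openBox (τ R : ℝ) : IsOpen (openBox n τ R) :=
  Metric.isOpen_ball.prod Metric.isOpen_ball

theorem isBounded_openBox (τ R : ℝ) : Bornology.IsBounded (openBox n τ R) :=
  Metric.isBounded_ball.prod Metric.isBounded_ball

theorem isConnected_openBox {τ R : ℝ} (hτ : 0 < τ) (hR : 0 < R) : IsConnected (openBox n τ R) :=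
  ((convex_ball _ _).prod (convex_ball _ _)).isConnected
    ⟨(0, 0), Metric.mem_ball_self hτ, Metric.mem_ball_self hR⟩

theorem isClosed_closedBox (τ R : ℝ) : IsClosed (closedBox n τ R) :=
  Metric.isClosed_closedBall.prod Metric.isClosed_closedBall

theorem closedBox_subset_openBox {τ R τ' R' : ℝ} (hτ : τ < τ') (hR : R < R') :
    closedBox n τ R ⊆ openBox n τ' R' :=
  Set.prod_mono (Metric.closedBall_subset_ball hτ) (Metric.closedBall_subset_ball hR)

theorem exists_measureReal_openBox (n : ℕ) : ∃ V : ℝ, 0 ≤ V ∧ ∀ τ R : ℝ, 0 < τ → 0 < R →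
    volume.real (openBox n τ R) = V * τ * R ^ n := by
  refine ⟨2 * volume.real (Metric.ball (0 : EuclideanSpace ℝ (Fin n)) 1), by positivity,
    fun τ R hτ hR => ?_⟩
  rw [openBox, Measure.volume_eq_prod, measureReal_prod_prod, Real.volume_real_ball hτ.le,
    measureReal_def (s := Metric.ball (0 : EuclideanSpace ℝ (Fin n)) R),
    Measure.addHaar_ball_of_pos _ _ hR, ENNReal.toReal_mul,
    ENNReal.toReal_ofReal (by positivity), finrank_euclideanSpace_fin, measureReal_def]
  ring

theorem norm_spaceGrad_le {f : SpaceTime n → ℝ} {p : SpaceTime n} {K : ℝ} (hK : 0 ≤ K)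
    (h : ∀ i, |fderiv ℝ f p (0, EuclideanSpace.single i 1)| ≤ K) :
    ‖spaceGrad f p‖ ≤ n * K := by
  rw [EuclideanSpace.norm_eq]
  refine Real.sqrt_le_iff.2 ⟨by positivity, ?_⟩
  have h1 : ∑ i, ‖spaceGrad f p i‖ ^ 2 ≤ n * K ^ 2 := by
    refine (Finset.sum_le_card_nsmul _ _ (K ^ 2) fun i _ => ?_).trans (by simp)
    exact pow_le_pow_left₀ (norm_nonneg _) (h i) 2
  have h2 : (n : ℝ) ≤ (n : ℝ) ^ 2 := by exact_mod_cast Nat.le_self_pow two_ne_zero n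
  nlinarith [mul_le_mul_of_nonneg_right h2 (sq_nonneg K)]

/-- Cut-off functions adapted to the anisotropic boxes, with derivative bounds that scale. -/
theorem exists_cutoff (n : ℕ) : ∃ C : ℝ, 0 ≤ C ∧ ∀ τ R : ℝ, 0 < τ → 0 < R →
    ∃ η : SpaceTime n → ℝ, ContDiff ℝ ∞ η ∧ (∀ p, 0 ≤ η p) ∧ (∀ p, η p ≤ 1) ∧
      tsupport η ⊆ closedBox n (2 * τ) (2 * R) ∧ (∀ p ∈ closedBox n τ R, η p = 1) ∧
      (∀ p ∈ closedBox n τ R, timeDeriv η p = 0) ∧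
      (∀ p ∈ closedBox n τ R, spaceGrad η p = 0) ∧
      (∀ p, |timeDeriv η p| ≤ C / τ) ∧ (∀ p, ‖spaceGrad η p‖ ≤ C / R) ∧
      (∀ p, ¬ (R < ‖p.2‖ ∧ ‖p.2‖ < 2 * R) → spaceGrad η p = 0) := by
  let χ₁ : ContDiffBump (0 : ℝ) := ⟨1, 2, one_pos, one_lt_two⟩
  let χ₂ : ContDiffBump (0 : EuclideanSpace ℝ (Fin n)) := ⟨1, 2, one_pos, one_lt_two⟩
  have hs₁ : ContDiff ℝ ∞ χ₁ := χ₁.contDiff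
  have hs₂ : ContDiff ℝ ∞ χ₂ := χ₂.contDiff
  obtain ⟨K₁, hK₁⟩ := (χ₁.hasCompactSupport.fderiv (𝕜 := ℝ)).exists_bound_of_continuous
    (hs₁.continuous_fderiv (by simp))
  obtain ⟨K₂, hK₂⟩ := (χ₂.hasCompactSupport.fderiv (𝕜 := ℝ)).exists_bound_of_continuous
    (hs₂.continuous_fderiv (by simp))
  have hK₁0 : 0 ≤ K₁ := (norm_nonneg _).trans (hK₁ 0)
  have hK₂0 : 0 ≤ K₂ := (norm_nonneg _).trans (hK₂ 0)
  refine ⟨K₁ + n * K₂, by positivity, fun τ R hτ hR => ?_⟩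
  let L₁ : SpaceTime n →L[ℝ] ℝ := τ⁻¹ • ContinuousLinearMap.fst ℝ ℝ _
  let L₂ : SpaceTime n →L[ℝ] EuclideanSpace ℝ (Fin n) := R⁻¹ • ContinuousLinearMap.snd ℝ ℝ _
  have hL₁ : ∀ p, ‖L₁ p‖ = τ⁻¹ * |p.1| := fun p => by
    simp [L₁, abs_of_pos hτ]
  have hL₂ : ∀ p, ‖L₂ p‖ = R⁻¹ * ‖p.2‖ := fun p => by
    simp [L₂, norm_smul, abs_of_pos hR]
  have hone₁ : ∀ p : SpaceTime n, |p.1| ≤ τ → χ₁ (L₁ p) = 1 := fun p hp =>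
    χ₁.one_of_mem_closedBall (by
      rw [mem_closedBall_zero_iff, hL₁]; exact (inv_mul_le_one₀ hτ).2 hp)
  have hone₂ : ∀ p : SpaceTime n, ‖p.2‖ ≤ R → χ₂ (L₂ p) = 1 := fun p hp =>
    χ₂.one_of_mem_closedBall (by
      rw [mem_closedBall_zero_iff, hL₂]; exact (inv_mul_le_one₀ hR).2 hp)
  have hzero₁ : ∀ p : SpaceTime n, 2 * τ ≤ |p.1| → χ₁ (L₁ p) = 0 := fun p hp =>
    χ₁.zero_of_le_dist (by
      rw [dist_zero_right, hL₁]; exact (le_inv_mul_iff₀' hτ).2 hp)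
  have hzero₂ : ∀ p : SpaceTime n, 2 * R ≤ ‖p.2‖ → χ₂ (L₂ p) = 0 := fun p hp =>
    χ₂.zero_of_le_dist (by
      rw [dist_zero_right, hL₂]; exact (le_inv_mul_iff₀' hR).2 hp)
  set η : SpaceTime n → ℝ := fun p => χ₁ (L₁ p) * χ₂ (L₂ p)
  have hη : ContDiff ℝ ∞ η := (hs₁.comp L₁.contDiff).mul (hs₂.comp L₂.contDiff)
  have hη0 : ∀ p, 0 ≤ η p := fun p => mul_nonneg χ₁.nonneg χ₂.nonneg
  have hη1 : ∀ p, η p ≤ 1 := fun p => mul_le_one₀ χ₁.le_one χ₂.nonneg χ₂.le_one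
  have hbox : ∀ p ∈ closedBox n τ R, η p = 1 := fun p hp => by
    obtain ⟨h1, h2⟩ := mem_closedBox.1 hp
    simp only [η, hone₁ p h1, hone₂ p h2, mul_one]
  have hboxd : ∀ p ∈ closedBox n τ R, fderiv ℝ η p = 0 := fun p hp =>
    IsLocalMax.fderiv_eq_zero (Eventually.of_forall fun x => by rw [hbox p hp]; exact hη1 x)
  have hfd : ∀ p v, fderiv ℝ η p v = χ₁ (L₁ p) * fderiv ℝ χ₂ (L₂ p) (L₂ v)
      + χ₂ (L₂ p) * fderiv ℝ χ₁ (L₁ p) (L₁ v) := fun p v => by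
    have h1 := (hs₁.differentiable (by simp) (L₁ p)).hasFDerivAt.comp p L₁.hasFDerivAt
    have h2 := (hs₂.differentiable (by simp) (L₂ p)).hasFDerivAt.comp p L₂.hasFDerivAt
    have h3 := (h1.mul h2).fderiv
    have h4 : fderiv ℝ η p = _ := h3
    rw [h4]
    simp
  refine ⟨η, hη, hη0, hη1, ?_, hbox, fun p hp => by simp [timeDeriv, hboxd p hp],
    fun p hp => by ext i; simp [spaceGrad, hboxd p hp], fun p => ?_, fun p => ?_, fun p hp => ?_⟩
  · refine closure_minimal (fun p hp => ?_) (isClosed_closedBox _ _)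
    rw [mem_closedBox]
    by_contra h
    refine hp ?_
    rcases not_and_or.1 h with h | h
    · simp only [η, hzero₁ p (not_le.1 h).le, zero_mul]
    · simp only [η, hzero₂ p (not_le.1 h).le, mul_zero]
  · have h0 : L₂ (1, 0) = 0 := by simp [L₂]
    have h1 : ‖L₁ ((1 : ℝ), (0 : EuclideanSpace ℝ (Fin n)))‖ = τ⁻¹ := by rw [hL₁]; simp
    rw [timeDeriv, hfd, h0, map_zero, mul_zero, zero_add, abs_mul, abs_of_nonneg χ₂.nonneg]
    calc χ₂ (L₂ p) * |fderiv ℝ χ₁ (L₁ p) (L₁ (1, 0))| ≤ 1 * (K₁ * τ⁻¹) := by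
          refine mul_le_mul χ₂.le_one ?_ (abs_nonneg _) zero_le_one
          refine ((fderiv ℝ χ₁ (L₁ p)).le_opNorm _).trans ?_
          rw [h1]
          exact mul_le_mul_of_nonneg_right (hK₁ _) (by positivity)
      _ ≤ (K₁ + n * K₂) / τ := by
          rw [one_mul, ← div_eq_mul_inv]
          exact div_le_div_of_nonneg_right (le_add_of_nonneg_right (by positivity)) hτ.le
  · refine (norm_spaceGrad_le (K := K₂ * R⁻¹) (by positivity) fun i => ?_).trans ?_
    · have h0 : L₁ (0, EuclideanSpace.single i (1 : ℝ)) = 0 := by simp [L₁]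
      have h1 : ‖L₂ ((0 : ℝ), EuclideanSpace.single i (1 : ℝ))‖ = R⁻¹ := by rw [hL₂]; simp
      rw [hfd, h0, map_zero, mul_zero, add_zero, abs_mul, abs_of_nonneg χ₁.nonneg]
      calc χ₁ (L₁ p) * |fderiv ℝ χ₂ (L₂ p) (L₂ (0, EuclideanSpace.single i 1))|
          ≤ 1 * (K₂ * R⁻¹) := by
            refine mul_le_mul χ₁.le_one ?_ (abs_nonneg _) zero_le_one
            refine ((fderiv ℝ χ₂ (L₂ p)).le_opNorm _).trans ?_
            rw [h1]
            exact mul_le_mul_of_nonneg_right (hK₂ _) (by positivity)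
        _ = K₂ * R⁻¹ := one_mul _
    · rw [← mul_assoc, ← div_eq_mul_inv]
      exact div_le_div_of_nonneg_right (le_add_of_nonneg_left hK₁0) hR.le
  · have h2 : fderiv ℝ χ₂ (L₂ p) = 0 := by
      rcases not_and_or.1 hp with h | h
      · exact IsLocalMax.fderiv_eq_zero (Eventually.of_forall fun x => by
          rw [hone₂ p (not_lt.1 h)]; exact χ₂.le_one)
      · exact IsLocalMin.fderiv_eq_zero (Eventually.of_forall fun x => by
          rw [hzero₂ p (not_lt.1 h)]; exact χ₂.nonneg)
    ext i
    have h0 : L₁ (0, EuclideanSpace.single i (1 : ℝ)) = 0 := by simp [L₁]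
    simp [spaceGrad, hfd, h0, h2]

end Cutoff

/-! ### The weighted a priori estimate -/

section Estimate

variable {n : ℕ} {a : SpaceTime n → Matrix (Fin n) (Fin n) ℝ} {A : SpaceTime n → ℝ} {α q c : ℝ}
  {u ut v vt : SpaceTime n → ℝ} {Gu Gv : SpaceTime n → EuclideanSpace ℝ (Fin n)}

theorem ae_le_of_annulusEssSup_le (hc : 0 ≤ c)
    (hA : ∀ R : ℝ, 1 < R → annulusEssSup A R ≤ ENNReal.ofReal (c * R ^ (2 - α)))
    {R : ℝ} (hR : 1 ≤ R) :
    ∀ᵐ p : SpaceTime n, R < ‖p.2‖ → ‖p.2‖ < 2 * R → A p ≤ c * (2 * R) ^ (2 - α) := by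
  have hm : MeasurableSet {p : SpaceTime n | 2 * R / 2 < ‖p.2‖ ∧ ‖p.2‖ < 2 * R} :=
    ((isOpen_lt continuous_const continuous_snd.norm).inter
      (isOpen_lt continuous_snd.norm continuous_const)).measurableSet
  have h := ENNReal.ae_le_essSup (μ := volume.restrict
    {p : SpaceTime n | 2 * R / 2 < ‖p.2‖ ∧ ‖p.2‖ < 2 * R}) fun p => ENNReal.ofReal (A p)
  filter_upwards [(ae_restrict_iff' hm).1 h] with p hp h1 h2
  have h3 := (hp ⟨by linarith, h2⟩).trans (hA (2 * R) (by linarith))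
  exact (ENNReal.ofReal_le_ofReal_iff (by positivity)).1 h3

theorem integrableOn_mul_one_add_rpow {Ω : Set (SpaceTime n)} (hb : Bornology.IsBounded Ω)
    {w ρ : SpaceTime n → ℝ} (hq : 1 < q) (hwm : AEMeasurable w (volume.restrict Ω))
    (hw : IntegrableOn (fun p => |w p| ^ q) Ω) (hρ : Measurable ρ) (hρ0 : ∀ p, 0 ≤ ρ p)
    (hρ1 : ∀ p, ρ p ≤ 1) {b r : ℝ} (hb0 : 0 ≤ b) (hrq : r ≤ q) :
    IntegrableOn (fun p => ρ p * (1 + b * |w p|) ^ r) Ω := by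
  have hfin : IsFiniteMeasure (volume.restrict Ω) :=
    isFiniteMeasure_restrict.2 hb.measure_lt_top.ne
  refine (((integrable_const (1 : ℝ)).add (hw.const_mul (b ^ q))).const_mul (2 ^ (q - 1))).mono'
    (hρ.aemeasurable.mul (((hwm.abs.const_mul b).const_add 1).pow_const r)).aestronglyMeasurable
    (ae_of_all _ fun p => ?_)
  have h0 : 0 ≤ b * |w p| := by positivity
  have h1 : (1 + b * |w p|) ^ r ≤ (1 + b * |w p|) ^ q :=
    Real.rpow_le_rpow_of_exponent_le (by linarith) hrq
  have h2 := one_add_rpow_le hq.le h0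
  rw [Real.mul_rpow hb0 (abs_nonneg _)] at h2
  have h3 : 0 ≤ (1 + b * |w p|) ^ r := Real.rpow_nonneg (by linarith) _
  rw [Real.norm_of_nonneg (mul_nonneg (hρ0 p) h3)]
  exact (mul_le_of_le_one_left h3 (hρ1 p)).trans (h1.trans h2)

/-- The diffusion terms of the tested inequality at a point: with `ζ = e ^ m` and
`d = -g'(w) > 0`, the energy term `-d ζ a(G, G)` absorbs the gradient in the mixed term. -/
theorem diffusion_term_le {p : SpaceTime n} (hs : ∀ i j, a p i j = a p j i)
    (h0 : ∀ ξ, 0 ≤ coeffForm a p ξ ξ) {m : ℕ} (hm : 2 ≤ m) {e d g : ℝ} (he : 0 ≤ e) (hd : 0 < d)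
    (hg0 : 0 ≤ g) (hg : g ≤ 2) (ξ G : EuclideanSpace ℝ (Fin n)) :
    g * coeffForm a p ((m * e ^ (m - 1)) • ξ) G + e ^ m * (-d) * coeffForm a p G G
      ≤ e ^ (m - 2) * (m ^ 2 / d * coeffForm a p ξ ξ) := by
  have h1 := mul_coeffForm_le hs h0 hd (g * m) ξ (e • G)
  rw [coeffForm_smul_right, coeffForm_smul_right, coeffForm_smul_left] at h1
  have h2 : (g * m) ^ 2 / (4 * d) ≤ m ^ 2 / d := by
    rw [div_le_div_iff₀ (by positivity) hd]
    have : g ^ 2 ≤ 4 := by nlinarith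
    have h3 : 0 ≤ (m : ℝ) ^ 2 * d := by positivity
    nlinarith
  have h3 := mul_le_mul_of_nonneg_right h2 (h0 ξ)
  obtain ⟨k, rfl⟩ := Nat.exists_eq_add_of_le hm
  have e1 : 2 + k - 1 = k + 1 := by omega
  have e2 : 2 + k - 2 = k := by omega
  rw [coeffForm_smul_left, e1, e2]
  have h4 := mul_le_mul_of_nonneg_left (h1.trans h3) (pow_nonneg he k)
  calc _ = e ^ k * (g * ((2 + k : ℕ) : ℝ) * (e * coeffForm a p ξ G)
        - d * (e * (e * coeffForm a p G G))) := by ring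
    _ ≤ _ := h4

/-- The weighted estimate behind the theorem. The constant depends neither on the size `R` of the
box nor on the amplitude `1 / b` at which the profile of the test function starts to decay; the
right-hand side only sees the region outside the inner box. -/
theorem exists_weighted_estimate (hc : 0 < c) (hq : 1 < q)
    (hL : IsDivFormOperator a A)
    (hA : ∀ R : ℝ, 1 < R → annulusEssSup A R ≤ ENNReal.ofReal (c * R ^ (2 - α)))
    (hu : MemWloc a q u ut Gu) (hv : MemWloc a q v vt Gv)
    (hweak : ∀ φ : SpaceTime n → ℝ, ContDiff ℝ ∞ φ → HasCompactSupport φ → (∀ p, 0 ≤ φ p) →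
      weakForm a q v vt Gv φ ≤ weakForm a q u ut Gu φ)
    (huv : ∀ᵐ p : SpaceTime n, v p ≤ u p) {μ : ℝ} (hμ : 0 < μ) (hμq : 1 + μ ≤ q) {m : ℕ}
    (hm : 2 ≤ m) :
    ∃ C : ℝ, 0 < C ∧ ∀ R : ℝ, 1 ≤ R → ∀ b : ℝ, 0 < b → ∃ η : SpaceTime n → ℝ,
      Continuous η ∧ (∀ p, 0 ≤ η p) ∧ (∀ p, η p ≤ 1) ∧
      (∀ p ∈ closedBox n (R ^ α) R, η p = 1) ∧
      ∫ p in openBox n (3 * R ^ α) (3 * R), |u p - v p| ^ q * η p ^ m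
        ≤ C * R ^ (-α) / b * ∫ p in openBox n (3 * R ^ α) (3 * R),
          ((closedBox n (R ^ α) R)ᶜ.indicator (fun p => η p ^ (m - 2)) p
            * (1 + b * |u p - v p|) ^ (1 + μ)) := by
  obtain ⟨K, hK, hcut⟩ := exists_cutoff n
  set c₀ : ℝ := μ * 2 ^ (-(μ / 2) - 1)
  have hc₀ : 0 < c₀ := mul_pos hμ (Real.rpow_pos_of_pos two_pos _)
  set C₁ : ℝ := m ^ 2 * (c * 2 ^ (2 - α) * K ^ 2) / c₀ + 2 * m * K
  have hC₁ : 0 ≤ C₁ := by positivity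
  have h2q : (0 : ℝ) < 2 ^ (q - 1) := Real.rpow_pos_of_pos two_pos _
  refine ⟨2 ^ (q - 1) * (C₁ + 1), by positivity, fun R hR b hb => ?_⟩
  have hR0 : 0 < R := by linarith
  have hτ : 0 < R ^ α := Real.rpow_pos_of_pos hR0 _
  obtain ⟨η, hη, hη0, hη1, hηs, hηbox, hηt, hηx, hηtK, hηxK, hηann⟩ := hcut (R ^ α) R hτ hR0
  refine ⟨η, hη.continuous, hη0, hη1, hηbox, ?_⟩
  set Ω := openBox n (3 * R ^ α) (3 * R)
  have hΩ : IsOpen Ω := isOpen_openBox _ _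
  have hΩb : Bornology.IsBounded Ω := isBounded_openBox _ _
  have hΩc : IsConnected Ω := isConnected_openBox (by positivity) (by positivity)
  have hu' := hu Ω hΩ hΩc hΩb
  have hv' := hv Ω hΩ hΩc hΩb
  have hm0 : m ≠ 0 := by omega
  have hηd : ∀ p, DifferentiableAt ℝ η p := fun p => hη.differentiable (by simp) p
  set ζ : SpaceTime n → ℝ := fun p => η p ^ m
  have hζ : ContDiff ℝ ∞ ζ := hη.pow m
  have hζη : tsupport ζ ⊆ tsupport η := closure_mono fun p hp h => hp (by
    simp only [ζ, h, zero_pow hm0])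
  have hζs : tsupport ζ ⊆ Ω := (hζη.trans hηs).trans
    (closedBox_subset_openBox (by linarith) (by linarith))
  have hζc : HasCompactSupport ζ := Metric.isCompact_of_isClosed_isBounded (isClosed_tsupport ζ)
    (hΩb.subset hζs)
  set g : ℝ → ℝ := fun s => profile μ (b * s)
  set g' : ℝ → ℝ := fun s => b * profileDeriv μ (b * s)
  have hg : ContDiff ℝ ∞ g := (contDiff_profile μ).comp (contDiff_const.mul contDiff_id)
  have hg' : ∀ s, HasDerivAt g (g' s) s := fun s => by
    have h1 : HasDerivAt (fun s => b * s) b s := by simpa using (hasDerivAt_id s).const_mul b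
    exact ((hasDerivAt_profile μ (b * s)).comp s h1).congr_deriv (mul_comm _ _)
  have hg'c : Continuous g' := by
    have : g' = deriv g := funext fun s => ((hg' s).deriv).symm
    rw [this]; exact hg.continuous_deriv (by simp)
  set H : ℝ → ℝ := fun s => ∫ x in (0 : ℝ)..s, g x
  have hHg : ∀ s, HasDerivAt H (g s) s := fun s => hg.continuous.integral_hasStrictDerivAt 0 s
    |>.hasDerivAt
  have hH : ContDiff ℝ ∞ H := by
    refine contDiff_infty_iff_deriv.2 ⟨fun s => (hHg s).differentiableAt, ?_⟩
    rwa [show deriv H = g from funext fun s => (hHg s).deriv]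
  have hg1 : ∀ s, 1 ≤ g s := fun s => one_le_profile _ _
  have hg2 : ∀ s, g s ≤ 2 := fun s => profile_le_two hμ.le _
  have hHle : ∀ s, |H s| ≤ 2 * |s| := fun s => by
    have := intervalIntegral.norm_integral_le_of_norm_le_const (a := 0) (b := s) (f := g) (C := 2)
      fun x _ => by
        rw [Real.norm_of_nonneg (zero_le_one.trans (hg1 x))]; exact hg2 x
    simpa using this
  have hg'M : ∀ s, |g' s| ≤ 2 + b * μ := fun s => by
    have h1 := mul_le_mul_of_nonneg_left (abs_profileDeriv_le hμ.le (b * s)) hb.le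
    simp only [g', abs_mul, abs_of_pos hb]
    linarith
  obtain ⟨hInt, hpos⟩ := weak_inequality_comp hL hq hΩ hΩb hu' hv' hweak hζ hζc hζs
    (fun p => pow_nonneg (hη0 p) m) hg hH hg' hg'c hHg (fun s => zero_le_one.trans (hg1 s))
    (M := 2 + b * μ) (fun s => (hg2 s).trans (le_add_of_nonneg_right (by positivity))) hg'M
  have hwL := (hu'.memLp hq hΩ).sub (hv'.memLp hq hΩ)
  have hwq : IntegrableOn (fun p => |u p - v p| ^ q) Ω := integrableOn_abs_rpow_of_memLp hq hwL
  have hI1 : IntegrableOn (fun p => |u p - v p| ^ q * η p ^ m) Ω :=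
    hwq.mul_bdd (c := 1) (hη.continuous.pow m).aestronglyMeasurable (ae_of_all _ fun p => by
      rw [Real.norm_of_nonneg (pow_nonneg (hη0 p) m)]; exact pow_le_one₀ (hη0 p) (hη1 p))
  have hρ0 : ∀ p, 0 ≤ (closedBox n (R ^ α) R)ᶜ.indicator (fun p => η p ^ (m - 2)) p := fun p =>
    Set.indicator_nonneg (fun p _ => pow_nonneg (hη0 p) _) p
  have hI2 : IntegrableOn (fun p => (closedBox n (R ^ α) R)ᶜ.indicator (fun p => η p ^ (m - 2)) p
      * (1 + b * |u p - v p|) ^ (1 + μ)) Ω :=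
    integrableOn_mul_one_add_rpow hΩb (w := fun p => u p - v p) hq
      (hu'.aemeasurable.sub hv'.aemeasurable) hwq
      ((hη.continuous.pow _).measurable.indicator (isClosed_closedBox _ _).measurableSet.compl)
      hρ0
      (fun p => Set.indicator_apply_le' (fun _ => pow_le_one₀ (hη0 p) (hη1 p))
        fun _ => zero_le_one) hb.le hμq
  -- the pointwise comparison of the integrands
  have hae := integral_mono_ae hInt ((hI2.const_mul (C₁ * R ^ (-α) / b)).sub
    (hI1.const_mul (2 ^ (q - 1))⁻¹)) (by
    filter_upwards [ae_restrict_of_ae hL.ae_symm, ae_restrict_of_ae hL.form_nonneg,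
      ae_restrict_of_ae hL.form_le, ae_restrict_of_ae huv,
      ae_restrict_of_ae (ae_le_of_annulusEssSup_le hc.le hA hR)] with p hs h0 hle huvp hAp
    have hw0 : 0 ≤ u p - v p := sub_nonneg.2 huvp
    set y : ℝ := u p - v p
    simp only [Pi.sub_apply]
    rw [abs_of_nonneg hw0]
    have hby : 0 ≤ b * y := mul_nonneg hb.le hw0
    set P : ℝ := (1 + b * y) ^ (1 + μ)
    have hP : 0 < P := Real.rpow_pos_of_pos (by linarith) _
    have hbyP : b * y ≤ P := by
      have : (1 + b * y) ^ (1 : ℝ) ≤ P :=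
        Real.rpow_le_rpow_of_exponent_le (by linarith) (by linarith)
      rw [Real.rpow_one] at this
      linarith
    have hd : b * (c₀ * P⁻¹) ≤ -g' y := by
      have h1 := mul_le_mul_of_nonneg_left (le_neg_profileDeriv hμ.le hby) hb.le
      rw [Real.rpow_neg (by linarith)] at h1
      simp only [g']
      linarith
    have hd0 : 0 < -g' y := lt_of_lt_of_le (by positivity) hd
    have hζx : spaceGrad ζ p = (m * η p ^ (m - 1)) • spaceGrad η p :=
      spaceGrad_comp (hasDerivAt_pow m (η p)) (hηd p)
    have hζt : timeDeriv ζ p = m * η p ^ (m - 1) * timeDeriv η p :=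
      timeDeriv_comp (hasDerivAt_pow m (η p)) (hηd p)
    have hem : 0 ≤ η p ^ (m - 2) := pow_nonneg (hη0 p) _
    have hF : (2 ^ (q - 1))⁻¹ * (y ^ q * η p ^ m)
        ≤ (|u p| ^ (q - 1) * u p - |v p| ^ (q - 1) * v p) * (ζ p * g y) := by
      have h1 : (2 ^ (q - 1))⁻¹ * y ^ q ≤ |u p| ^ (q - 1) * u p - |v p| ^ (q - 1) * v p :=
        (inv_mul_le_iff₀ h2q).2 (rpow_sub_le_mul_sub hq huvp)
      have h2 : 0 ≤ (2 ^ (q - 1))⁻¹ * y ^ q :=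
        mul_nonneg (inv_nonneg.2 h2q.le) (Real.rpow_nonneg hw0 _)
      have h3 : η p ^ m ≤ ζ p * g y := le_mul_of_one_le_right (pow_nonneg (hη0 p) m) (hg1 y)
      rw [← mul_assoc]
      exact mul_le_mul h1 h3 (pow_nonneg (hη0 p) m) (h2.trans h1)
    have hD := diffusion_term_le hs h0 hm (hη0 p) hd0 (zero_le_one.trans (hg1 y)) (hg2 y)
      (spaceGrad η p) (Gu p - Gv p)
    rw [neg_neg, ← hζx] at hD
    by_cases hp : p ∈ closedBox n (R ^ α) R
    · rw [Set.indicator_of_notMem (by simpa using hp), zero_mul, mul_zero, hζt, hηt p hp]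
      rw [hηx p hp, coeffForm_zero_left, mul_zero, mul_zero] at hD
      simp only [mul_zero, zero_mul, sub_zero]
      exact sub_le_sub hD hF
    · rw [Set.indicator_of_mem (by simpa using hp)]
      have hT : -(timeDeriv ζ p * H y) ≤ 2 * m * K * R ^ (-α) / b * (η p ^ (m - 2) * P) := by
        refine (neg_le_abs _).trans ?_
        have h1 : η p ^ (m - 1) ≤ η p ^ (m - 2) :=
          pow_le_pow_of_le_one (hη0 p) (hη1 p) (by omega)
        have h2 := hHle y
        rw [abs_of_nonneg hw0] at h2
        have h3 : y ≤ P / b := by rw [le_div_iff₀ hb]; linarith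
        rw [hζt, abs_mul, abs_mul, abs_of_nonneg (mul_nonneg (Nat.cast_nonneg m)
          (pow_nonneg (hη0 p) (m - 1)))]
        calc m * η p ^ (m - 1) * |timeDeriv η p| * |H y|
            ≤ m * η p ^ (m - 2) * (K / R ^ α) * (2 * (P / b)) := by
              gcongr
              · exact hηtK p
              · exact h2.trans (by linarith)
          _ = _ := by rw [Real.rpow_neg hR0.le]; ring
      have hE : coeffForm a p (spaceGrad η p) (spaceGrad η p)
          ≤ c * 2 ^ (2 - α) * K ^ 2 * R ^ (-α) := by
        by_cases hann : R < ‖p.2‖ ∧ ‖p.2‖ < 2 * R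
        · calc _ ≤ A p * ‖spaceGrad η p‖ ^ 2 := hle _
            _ ≤ c * (2 * R) ^ (2 - α) * (K / R) ^ 2 := by
              gcongr
              · exact hAp hann.1 hann.2
              · exact hηxK p
            _ = _ := by
              rw [Real.mul_rpow zero_le_two hR0.le, sub_eq_add_neg 2 α, Real.rpow_add hR0,
                Real.rpow_two, ← sub_eq_add_neg]
              field_simp
        · rw [hηann p hann, coeffForm_zero_left]
          have := Real.rpow_nonneg hR0.le (-α)
          have := Real.rpow_nonneg zero_le_two (2 - α)
          positivity
      have hD' : η p ^ (m - 2) * (m ^ 2 / -g' y *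
          coeffForm a p (spaceGrad η p) (spaceGrad η p))
          ≤ m ^ 2 * (c * 2 ^ (2 - α) * K ^ 2) / c₀ * R ^ (-α) / b * (η p ^ (m - 2) * P) := by
        calc _ ≤ η p ^ (m - 2) * (m ^ 2 / (b * (c₀ * P⁻¹)) *
              (c * 2 ^ (2 - α) * K ^ 2 * R ^ (-α))) := by
              gcongr
              exact h0 _
          _ = _ := by field_simp
      have hsum : C₁ * R ^ (-α) / b * (η p ^ (m - 2) * P)
          = m ^ 2 * (c * 2 ^ (2 - α) * K ^ 2) / c₀ * R ^ (-α) / b * (η p ^ (m - 2) * P)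
            + 2 * m * K * R ^ (-α) / b * (η p ^ (m - 2) * P) := by
        simp only [C₁]; ring
      rw [hsum]
      linarith [hD.trans hD'])
  have hsub := integral_sub (hI2.const_mul (C₁ * R ^ (-α) / b)) (hI1.const_mul (2 ^ (q - 1))⁻¹)
  have h3 := (hpos.trans hae).trans_eq hsub
  rw [integral_const_mul, integral_const_mul] at h3
  set J := ∫ p in Ω, ((closedBox n (R ^ α) R)ᶜ.indicator (fun p => η p ^ (m - 2)) p
            * (1 + b * |u p - v p|) ^ (1 + μ))
  have hJ : 0 ≤ J := integral_nonneg fun p =>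
    mul_nonneg (hρ0 p) (Real.rpow_nonneg (by positivity) _)
  have h4 := (inv_mul_le_iff₀ h2q).1 (sub_nonneg.1 h3)
  refine h4.trans ?_
  have h5 : 0 ≤ 2 ^ (q - 1) * (R ^ (-α) / b * J) := by positivity
  calc _ = 2 ^ (q - 1) * C₁ * (R ^ (-α) / b * J) := by ring
    _ ≤ 2 ^ (q - 1) * C₁ * (R ^ (-α) / b * J) + 2 ^ (q - 1) * (R ^ (-α) / b * J) := by linarith
    _ = _ := by ring

end Estimate

/-! ### Global integrability and vanishing -/

section Vanishing

theorem scaling_mul_rpow {α q R B : ℝ} (hq : 1 < q) (hR : 0 < R) (hB : 0 < B) :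
    R ^ (-α) / (B * R ^ (α / (q - 1))) * (B * R ^ (α / (q - 1))) ^ q = B ^ (q - 1) := by
  have hb : 0 < B * R ^ (α / (q - 1)) := mul_pos hB (Real.rpow_pos_of_pos hR _)
  have hq1 : q - 1 ≠ 0 := by linarith
  rw [div_mul_eq_mul_div, mul_div_assoc, ← Real.rpow_sub_one hb.ne',
    Real.mul_rpow hB.le (Real.rpow_nonneg hR.le _), ← Real.rpow_mul hR.le,
    div_mul_cancel₀ _ hq1, mul_left_comm, ← Real.rpow_add hR, neg_add_cancel, Real.rpow_zero,
    mul_one]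

/-- This is where the condition `q ≤ 1 + α / n` enters. -/
theorem scaling_mul_volume_le {n : ℕ} (hn : 1 ≤ n) {α q R B V : ℝ} (hq : 1 < q)
    (hq' : q ≤ 1 + α / n) (hR : 1 ≤ R) (hB : 0 < B) (hV : 0 ≤ V) :
    R ^ (-α) / (B * R ^ (α / (q - 1))) * (V * (3 * R ^ α) * (3 * R) ^ n)
      ≤ V * 3 ^ (n + 1) / B := by
  have hR0 : 0 < R := by linarith
  have hn0 : (0 : ℝ) < n := by exact_mod_cast hn
  have hκ : (n : ℝ) ≤ α / (q - 1) := by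
    rw [le_div_iff₀ (by linarith)]
    have : q - 1 ≤ α / n := by linarith
    rw [le_div_iff₀ hn0] at this
    linarith
  have h1 : R ^ n ≤ R ^ (α / (q - 1)) := by
    rw [← Real.rpow_natCast]; exact Real.rpow_le_rpow_of_exponent_le hR hκ
  have hRα : R ^ (-α) * R ^ α = 1 := by
    rw [← Real.rpow_add hR0, neg_add_cancel, Real.rpow_zero]
  have hRβ : 0 < R ^ (α / (q - 1)) := Real.rpow_pos_of_pos hR0 _
  calc _ = (R ^ (-α) * R ^ α) * (V * 3 ^ (n + 1) / B) * (R ^ n / R ^ (α / (q - 1))) := by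
        rw [mul_pow, pow_succ]; field_simp
    _ ≤ 1 * (V * 3 ^ (n + 1) / B) * 1 := by
        rw [hRα]
        exact mul_le_mul_of_nonneg_left (div_le_one_of_le₀ h1 hRβ.le) (by positivity)
    _ = _ := by ring

/-- The closed boxes `{|t| ≤ R ^ α, |x| ≤ R}`, `R = k + 1`, exhaust space-time. -/
theorem aecover_closedBox (n : ℕ) {α : ℝ} (hα : 0 < α) :
    AECover (volume : Measure (SpaceTime n)) atTop
      fun k : ℕ => closedBox n (((k : ℝ) + 1) ^ α) ((k : ℝ) + 1) := by
  refine ⟨ae_of_all _ fun p => ?_, fun k => (isClosed_closedBox _ _).measurableSet⟩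
  have h1 : Tendsto (fun k : ℕ => (k : ℝ) + 1) atTop atTop :=
    tendsto_atTop_add_const_right _ _ tendsto_natCast_atTop_atTop
  filter_upwards [((tendsto_rpow_atTop hα).comp h1).eventually_ge_atTop |p.1|,
    h1.eventually_ge_atTop ‖p.2‖] with k hk1 hk2
  exact mem_closedBox.2 ⟨hk1, hk2⟩

theorem exists_cutoff_exponent {r : ℝ} (hr : r < 1) : ∃ m : ℕ, m * r + 2 ≤ m := by
  obtain ⟨m, hm⟩ := exists_nat_ge (2 / (1 - r))
  refine ⟨m, ?_⟩
  rw [div_le_iff₀ (by linarith)] at hm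
  linarith

end Vanishing

end

theorem theorem1 (n : ℕ) (hn : 1 ≤ n) (α q c : ℝ) (hα : 0 < α) (hc : 0 < c)
    (hq : 1 < q) (hq' : q ≤ 1 + α / (n : ℝ))
    (a : SpaceTime n → Matrix (Fin n) (Fin n) ℝ) (A : SpaceTime n → ℝ)
    (hL : IsDivFormOperator a A)
    (hA : ∀ R : ℝ, 1 < R → annulusEssSup A R ≤ ENNReal.ofReal (c * R ^ (2 - α)))
    (u v : SpaceTime n → ℝ) (hsol : IsWeakSolution a q u v)
    (huv : ∀ᵐ p : SpaceTime n, v p ≤ u p) :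
    ∀ᵐ p : SpaceTime n, u p = v p := by
  obtain ⟨hum, hvm, ut, vt, Gu, Gv, hu, hv, hweak⟩ := hsol
  obtain ⟨V, hV0, hV⟩ := exists_measureReal_openBox n
  have hq0 : 0 < q := by linarith
  -- `1 + μ < q` is what allows absorption
  set μ : ℝ := (q - 1) / 2
  have hμ : 0 < μ := by simp only [μ]; linarith
  have hμq : 1 + μ < q := by simp only [μ]; linarith
  obtain ⟨m, hmr⟩ := exists_cutoff_exponent (r := (1 + μ) / q) ((div_lt_one hq0).2 hμq)
  have hm : 2 ≤ m := by
    have h1 : (0 : ℝ) ≤ m * ((1 + μ) / q) := by positivity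
    have : ((2 : ℕ) : ℝ) ≤ m := by push_cast; linarith
    exact_mod_cast this
  obtain ⟨C, hC, hest⟩ := exists_weighted_estimate (α := α) hc hq hL hA hu hv hweak huv hμ hμq.le hm
  have hwm : AEMeasurable (fun p => u p - v p) (volume : Measure (SpaceTime n)) := hum.sub hvm
  have hwΩ : ∀ τ R : ℝ, 0 < τ → 0 < R →
      IntegrableOn (fun p => |u p - v p| ^ q) (openBox n τ R) := fun τ R hτ hR => by
    have hΩ := isOpen_openBox (n := n) τ R
    have hΩc := isConnected_openBox (n := n) hτ hR
    have hΩb := isBounded_openBox (n := n) τ R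
    exact integrableOn_abs_rpow_of_memLp hq (((hu _ hΩ hΩc hΩb).memLp hq hΩ).sub
      ((hv _ hΩ hΩc hΩb).memLp hq hΩ))
  have hcover := aecover_closedBox n hα
  -- restriction of the cut-off integral to the inner box
  have hinner : ∀ R : ℝ, 1 ≤ R → ∀ η : SpaceTime n → ℝ, Continuous η → (∀ p, 0 ≤ η p) →
      (∀ p, η p ≤ 1) → (∀ p ∈ closedBox n (R ^ α) R, η p = 1) →
      IntegrableOn (fun p => |u p - v p| ^ q * η p ^ m) (openBox n (3 * R ^ α) (3 * R)) ∧
      ∫ p in closedBox n (R ^ α) R, |u p - v p| ^ q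
        ≤ ∫ p in openBox n (3 * R ^ α) (3 * R), |u p - v p| ^ q * η p ^ m := by
    intro R hR η hη hη0 hη1 hη2
    have hR0 : 0 < R := by linarith
    have hτ : 0 < R ^ α := Real.rpow_pos_of_pos hR0 _
    have hi : IntegrableOn (fun p => |u p - v p| ^ q * η p ^ m)
        (openBox n (3 * R ^ α) (3 * R)) :=
      (hwΩ _ _ (by positivity) (by positivity)).mul_bdd (c := 1)
        (hη.pow m).aestronglyMeasurable (ae_of_all _ fun p => by
          rw [Real.norm_of_nonneg (pow_nonneg (hη0 p) m)]; exact pow_le_one₀ (hη0 p) (hη1 p))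
    refine ⟨hi, ?_⟩
    rw [setIntegral_congr_fun (g := fun p => |u p - v p| ^ q * η p ^ m)
      (isClosed_closedBox _ _).measurableSet fun p hp => by simp only [hη2 p hp, one_pow, mul_one]]
    refine setIntegral_mono_set hi (ae_of_all _ fun p => ?_)
      (closedBox_subset_openBox (by linarith) (by linarith)).eventuallyLE
    exact mul_nonneg (Real.rpow_nonneg (abs_nonneg _) _) (pow_nonneg (hη0 p) m)
  have hindle : ∀ (R : ℝ) (η : SpaceTime n → ℝ), (∀ p, 0 ≤ η p) → ∀ p,
      (closedBox n (R ^ α) R)ᶜ.indicator (fun p => η p ^ (m - 2)) p ≤ η p ^ (m - 2) :=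
    fun R η hη0 p => Set.indicator_apply_le' (fun _ => le_rfl) fun _ => pow_nonneg (hη0 p) _
  have hvol : ∀ R : ℝ, volume (openBox n (3 * R ^ α) (3 * R)) ≠ ⊤ := fun R =>
    (isBounded_openBox _ _).measure_lt_top.ne
  have hInt : Integrable fun p : SpaceTime n => |u p - v p| ^ q := by
    obtain ⟨K, hK, hyoung⟩ := exists_cutoff_young (p := 1 + μ) (τ := (2 * C)⁻¹) (by linarith) hq
      hμq (by positivity) hmr
    refine hcover.integrable_of_integral_norm_bounded (2 * (C * K * (V * 3 ^ (n + 1))))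
      (fun k => (hwΩ (2 * ((k : ℝ) + 1) ^ α) (2 * ((k : ℝ) + 1)) (by positivity)
        (by positivity)).mono_set ?_) (Eventually.of_forall fun k => ?_)
    · have h1 : (0 : ℝ) < ((k : ℝ) + 1) ^ α := by positivity
      have h2 : (0 : ℝ) < (k : ℝ) + 1 := by positivity
      exact closedBox_subset_openBox (by linarith) (by linarith)
    have hR : (1 : ℝ) ≤ (k : ℝ) + 1 := by simp
    set R : ℝ := (k : ℝ) + 1
    have hR0 : 0 < R := by linarith
    have hτ : 0 < R ^ α := Real.rpow_pos_of_pos hR0 _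
    -- the inverse of the natural amplitude `R ^ (-α / (q - 1))` of solutions on a box of size `R`,
    -- with the factor `B = 1` of the scaling lemmas
    set b : ℝ := 1 * R ^ (α / (q - 1))
    have hb : 0 < b := by positivity
    obtain ⟨η, hη, hη0, hη1, hη2, hle⟩ := hest R hR b hb
    obtain ⟨hi, hin⟩ := hinner R hR η hη hη0 hη1 hη2
    simp only [Real.norm_of_nonneg (Real.rpow_nonneg (abs_nonneg _) q)]
    refine hin.trans ?_
    set Ω := openBox n (3 * R ^ α) (3 * R)
    set I := ∫ p in Ω, |u p - v p| ^ q * η p ^ m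
    have hJ : ∫ p in Ω, ((closedBox n (R ^ α) R)ᶜ.indicator (fun p => η p ^ (m - 2)) p
        * (1 + b * |u p - v p|) ^ (1 + μ))
        ≤ K * (V * (3 * R ^ α) * (3 * R) ^ n) + (2 * C)⁻¹ * b ^ q * I := by
      have hconst : IntegrableOn (fun _ : SpaceTime n => K) Ω :=
        integrableOn_const (hvol R)
      have h1 : ∫ p in Ω, (K + (2 * C)⁻¹ * b ^ q * (|u p - v p| ^ q * η p ^ m))
          = K * (V * (3 * R ^ α) * (3 * R) ^ n) + (2 * C)⁻¹ * b ^ q * I := by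
        rw [integral_add hconst (hi.const_mul _), integral_const_mul, setIntegral_const,
          hV _ _ (by positivity) (by positivity), smul_eq_mul, mul_comm K]
      rw [← h1]
      refine integral_mono_of_nonneg (ae_of_all _ fun p => mul_nonneg
        (Set.indicator_nonneg (fun p _ => pow_nonneg (hη0 p) _) p)
        (Real.rpow_nonneg (by positivity) _)) (hconst.add (hi.const_mul _))
        (ae_of_all _ fun p => ?_)
      have hy := hyoung (η p) (b * |u p - v p|) (hη0 p) (hη1 p) (by positivity)
      rw [Real.mul_rpow hb.le (abs_nonneg _)] at hy
      calc _ ≤ η p ^ (m - 2) * (1 + b * |u p - v p|) ^ (1 + μ) :=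
            mul_le_mul_of_nonneg_right (hindle R η hη0 p) (Real.rpow_nonneg (by positivity) _)
        _ ≤ _ := hy
        _ = _ := by ring
    have h2 : C * R ^ (-α) / b * (K * (V * (3 * R ^ α) * (3 * R) ^ n) + (2 * C)⁻¹ * b ^ q * I)
        ≤ C * K * (V * 3 ^ (n + 1)) + 1 / 2 * I := by
      have s1 := scaling_mul_rpow (α := α) hq hR0 one_pos
      have s2 := scaling_mul_volume_le hn hq hq' hR one_pos hV0
      rw [Real.one_rpow] at s1
      rw [div_one] at s2
      have s3 := mul_le_mul_of_nonneg_left s2 (mul_nonneg hC.le hK)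
      calc _ = C * K * (R ^ (-α) / b * (V * (3 * R ^ α) * (3 * R) ^ n))
            + C * (2 * C)⁻¹ * (R ^ (-α) / b * b ^ q) * I := by ring
        _ = C * K * (R ^ (-α) / b * (V * (3 * R ^ α) * (3 * R) ^ n)) + 1 / 2 * I := by
          rw [s1]; field_simp
        _ ≤ _ := by linarith
    have h3 := mul_le_mul_of_nonneg_left hJ
      (show 0 ≤ C * R ^ (-α) / b by positivity)
    linarith
  set T : ℝ := ∫ p : SpaceTime n, |u p - v p| ^ q
  have hT0 : 0 ≤ T := integral_nonneg fun p => Real.rpow_nonneg (abs_nonneg _) _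
  have hTB : ∀ B : ℝ, 0 < B → T ≤ C * 2 ^ (q - 1) * (V * 3 ^ (n + 1)) / B := by
    intro B hB
    have hlim := hcover.integral_tendsto_of_countably_generated hInt
    have hlim2 := (((hlim.const_sub T).const_mul (C * 2 ^ (q - 1) * B ^ (q - 1))).const_add
      (C * 2 ^ (q - 1) * (V * 3 ^ (n + 1)) / B))
    rw [sub_self, mul_zero, add_zero] at hlim2
    refine le_of_tendsto_of_tendsto' hlim hlim2 fun k => ?_
    have hR : (1 : ℝ) ≤ (k : ℝ) + 1 := by simp
    set R : ℝ := (k : ℝ) + 1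
    have hR0 : 0 < R := by linarith
    have hτ : 0 < R ^ α := Real.rpow_pos_of_pos hR0 _
    -- the inverse of an amplitude smaller than the natural one by the factor `1 / B`
    set b : ℝ := B * R ^ (α / (q - 1))
    have hb : 0 < b := by positivity
    obtain ⟨η, hη, hη0, hη1, hη2, hle⟩ := hest R hR b hb
    obtain ⟨-, hin⟩ := hinner R hR η hη hη0 hη1 hη2
    refine hin.trans (hle.trans ?_)
    set Ω := openBox n (3 * R ^ α) (3 * R)
    set Q := closedBox n (R ^ α) R
    have hQ : MeasurableSet Q := (isClosed_closedBox _ _).measurableSet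
    have hcompl : ∫ p in Qᶜ, |u p - v p| ^ q = T - ∫ p in Q, |u p - v p| ^ q := by
      rw [eq_sub_iff_add_eq', integral_add_compl hQ hInt]
    have hconst : IntegrableOn (fun _ : SpaceTime n => (1 : ℝ)) Ω := integrableOn_const (hvol R)
    have hind : Integrable (Qᶜ.indicator fun p : SpaceTime n => |u p - v p| ^ q) :=
      hInt.indicator hQ.compl
    have hJ : ∫ p in Ω, (Qᶜ.indicator (fun p => η p ^ (m - 2)) p
        * (1 + b * |u p - v p|) ^ (1 + μ)) ≤ 2 ^ (q - 1) * (V * (3 * R ^ α) * (3 * R) ^ n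
          + b ^ q * (T - ∫ p in Q, |u p - v p| ^ q)) := by
      have h1 : ∫ p in Ω, 2 ^ (q - 1) * (1 + b ^ q * Qᶜ.indicator (fun p => |u p - v p| ^ q) p)
          ≤ 2 ^ (q - 1) * (V * (3 * R ^ α) * (3 * R) ^ n
          + b ^ q * (T - ∫ p in Q, |u p - v p| ^ q)) := by
        rw [integral_const_mul, integral_add hconst (hind.integrableOn.const_mul _),
          integral_const_mul, setIntegral_const, hV _ _ (by positivity) (by positivity),
          smul_eq_mul, mul_one, ← hcompl, ← integral_indicator hQ.compl]
        gcongr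
        · exact ae_of_all _ fun p => Set.indicator_nonneg
            (fun p _ => Real.rpow_nonneg (abs_nonneg _) _) p
        · exact Measure.restrict_le_self
      refine le_trans ?_ h1
      refine integral_mono_of_nonneg (ae_of_all _ fun p => mul_nonneg
        (Set.indicator_nonneg (fun p _ => pow_nonneg (hη0 p) _) p)
        (Real.rpow_nonneg (by positivity) _))
        ((hconst.add (hind.integrableOn.const_mul _)).const_mul _) (ae_of_all _ fun p => ?_)
      have hbw : 0 ≤ b * |u p - v p| := by positivity
      simp only
      by_cases hp : p ∈ Qᶜ
      · rw [Set.indicator_of_mem hp, Set.indicator_of_mem hp, ← Real.mul_rpow hb.le (abs_nonneg _)]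
        refine (mul_le_of_le_one_left (Real.rpow_nonneg (by positivity) _)
          (pow_le_one₀ (hη0 p) (hη1 p))).trans ?_
        exact (Real.rpow_le_rpow_of_exponent_le (by linarith) hμq.le).trans
          (one_add_rpow_le hq.le hbw)
      · rw [Set.indicator_of_notMem hp, Set.indicator_of_notMem hp]
        simp only [zero_mul, mul_zero, add_zero, mul_one]
        positivity
    have s1 := scaling_mul_rpow (α := α) hq hR0 hB
    have s2 := scaling_mul_volume_le hn hq hq' hR hB hV0
    have h3 := mul_le_mul_of_nonneg_left hJ (show 0 ≤ C * R ^ (-α) / b by positivity)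
    have s3 := mul_le_mul_of_nonneg_left s2 (show 0 ≤ C * 2 ^ (q - 1) by positivity)
    refine h3.trans ?_
    calc _ = C * 2 ^ (q - 1) * (R ^ (-α) / b * (V * (3 * R ^ α) * (3 * R) ^ n))
          + C * 2 ^ (q - 1) * (R ^ (-α) / b * b ^ q) * (T - ∫ p in Q, |u p - v p| ^ q) := by ring
      _ ≤ _ := by
        rw [s1]
        refine add_le_add (s3.trans_eq (by ring)) le_rfl
  have hT : T = 0 := by
    refine le_antisymm ?_ hT0
    have h1 : Tendsto (fun B : ℝ => C * 2 ^ (q - 1) * (V * 3 ^ (n + 1)) / B) atTop (𝓝 0) :=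
      tendsto_const_nhds.div_atTop tendsto_id
    exact ge_of_tendsto h1 (by filter_upwards [eventually_gt_atTop 0] with B hB using hTB B hB)
  have h0 := (integral_eq_zero_iff_of_nonneg
    (fun p => Real.rpow_nonneg (abs_nonneg (u p - v p)) q) hInt).1 hT
  filter_upwards [h0] with p hp
  rw [Pi.zero_apply, Real.rpow_eq_zero (abs_nonneg _) hq0.ne', abs_eq_zero] at hp
  exact sub_eq_zero.1 hp
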